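/- Let $q\ge 2$ be an integer and let $\mathcal T$ be a complete, deterministic, subsequential transducer with finitely many states and input alphabet $\{0,\dots,q-1\}$: it has one initial state, for every state and every input digit exactly one transition, an output label on every transition and a final output label at every state. For $n\ge 0$ let $\mathcal T(n)$ be the sum of the transition outputs along the path that starts in the initial state and reads the standard $q$-ary expansion of $n$ from the least significant to the most significant digit, without leading zeros (the empty word for $n=0$), plus the final output of the last state of this path. Let $\mathbb E_N=\frac1N\sum_{0\le n<N}\mathcal T(n)$ be the expected value of $\mathcal T(n)$ for $n$ uniformly distributed on $\{0,\dots,N-1\}$. Assume that all output labels and all final output labels of $\mathcal T$ are integers and that $\mathcal T$ has a reset sequence, i.e., there are an input word and a state $r$ such that reading this word from any state leads to $r$. For $t\in\mathbb R$ let $M(t)$ be the matrix, indexed by the states, whose $(s,s')$ entry is the sum of $e^{it\delta}$ over all transitions from $s$ to $s'$, where $\delta$ is the output of the transition. Let $\mu(t)$ be the eigenvalue of $M(t)$ of largest modulus, for $t$ in a neighbourhood of $0$ (so $\mu(0)=q$), and let $e_{\mathcal T}=-i\,q^{-1}\mu'(0)\in\mathbb R$. Assume that $e_{\mathcal T}\notin\mathbb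 Z$. Then there is exactly one continuous $1$-periodic function $\Psi_1\colon\mathbb R\to\mathbb R$ such that, for some $\xi>0$, $$\mathbb E_N=e_{\mathcal T}\log_q N+\Psi_1(\log_q N)+\mathcal O(N^{-\xi}\log N)\qquad(N\to\infty),$$ and this function $\Psi_1$ is not differentiable at any $x\in\mathbb R$. -/

import Mathlib

open Filter Topology Asymptotics

/-- A dominant eigenvalue of a square complex matrix: an eigenvalue of maximal modulus. -/
def IsDominantEigenvalue {S : Type*} [Fintype S] [DecidableEq S]
    (A : Matrix S S ℂ) (z : ℂ) : Prop :=
  Module.End.HasEigenvalue (Matrix.toLin' A) z ∧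
    ∀ w : ℂ, Module.End.HasEigenvalue (Matrix.toLin' A) w → ‖w‖ ≤ ‖z‖

theorem exists_isDominantEigenvalue {S : Type*} [Fintype S] [DecidableEq S] [Nonempty S]
    (A : Matrix S S ℂ) : ∃ z : ℂ, IsDominantEigenvalue A z := by
  have hfin : (spectrum ℂ (Matrix.toLin' A)).Finite :=
    Module.End.finite_spectrum (Matrix.toLin' A)
  obtain ⟨c, hc⟩ := Module.End.exists_eigenvalue (Matrix.toLin' A)
  obtain ⟨z, hz, hmax⟩ := hfin.exists_maximalFor (fun w => ‖w‖) _
    ⟨c, Module.End.hasEigenvalue_iff_mem_spectrum.1 hc⟩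
  refine ⟨z, Module.End.hasEigenvalue_iff_mem_spectrum.2 hz, fun w hw => ?_⟩
  rcases le_total ‖w‖ ‖z‖ with h | h
  · exact h
  · exact hmax (Module.End.hasEigenvalue_iff_mem_spectrum.1 hw) h

/-- A complete, deterministic, subsequential transducer with input alphabet `{0, …, q - 1}`
and real outputs: exactly one transition for each state and each input digit, an output label
for every transition, a final output label for every state, and one initial state. -/
structure Transducer (q : ℕ) (S : Type*) where
  initial : S
  next : S → Fin q → S
  output : S → Fin q → ℝ
  finalOutput : S → ℝ

namespace Transducer

variable {q : ℕ} {S : Type*}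

/-- The state reached from the state `s` by an input word. Words are lists of digits in the order
in which they are read. -/
def stateAfter (T : Transducer q S) (s : S) (w : List (Fin q)) : S :=
  w.foldl T.next s

/-- The sum of all outputs, final output included, when an input word is read from state `s`. -/
def outputSum (T : Transducer q S) : S → List (Fin q) → ℝ
  | s, [] => T.finalOutput s
  | s, d :: w => T.output s d + T.outputSum (T.next s d) w

/-- The standard `q`-ary digits of `n`, least significant digit first, without leading zeros
(the empty word for `n = 0`). -/
def inputWord (q : ℕ) [NeZero q] (n : ℕ) : List (Fin q) :=
  (Nat.digits q n).map (Fin.ofNat q)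

/-- `𝒯(n)`: the output sum for the `q`-ary expansion of `n`, read from the least significant
digit to the most significant digit, starting in the initial state. -/
def value [NeZero q] (T : Transducer q S) (n : ℕ) : ℝ :=
  T.outputSum T.initial (inputWord q n)

/-- The expected value of `𝒯(n)` for `n` uniformly distributed on `{0, …, N - 1}`. -/
noncomputable def expectedValue [NeZero q] (T : Transducer q S) (N : ℕ) : ℝ :=
  (∑ n ∈ Finset.range N, T.value n) / N

/-- The output alphabet is `ℤ` (for transitions and for final outputs). -/
def HasIntegerOutput (T : Transducer q S) : Prop :=
  (∀ s d, ∃ k : ℤ, T.output s d = k) ∧ ∀ s, ∃ k : ℤ, T.finalOutput s = k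

/-- Some input word leads from every state to one and the same state. -/
def HasResetSequence (T : Transducer q S) : Prop :=
  ∃ (w : List (Fin q)) (r : S), ∀ s, T.stateAfter s w = r

/-- The transition matrix for the input digit `d` at the parameter `t`. -/
noncomputable def digitMatrix [DecidableEq S] (T : Transducer q S) (d : Fin q) (t : ℝ) :
    Matrix S S ℂ :=
  Matrix.of fun s s' =>
    if T.next s d = s' then Complex.exp (Complex.I * t * T.output s d) else 0

/-- The sum `M(t)` of the transition matrices of all digits. -/
noncomputable def transitionMatrix [DecidableEq S] (T : Transducer q S) (t : ℝ) :
    Matrix S S ℂ :=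
  ∑ d : Fin q, T.digitMatrix d t

/-- The dominant eigenvalue `μ(t)` of `M(t)`. For a transducer with a reset sequence it is unique
for all `t` near `0`, and `μ(0) = q`; where there are several, one of them is chosen. -/
noncomputable def dominantEigenvalue [Fintype S] [DecidableEq S] (T : Transducer q S) (t : ℝ) : ℂ :=
  haveI : Nonempty S := ⟨T.initial⟩
  Classical.choose (exists_isDominantEigenvalue (T.transitionMatrix t))

/-- The constant `e_𝒯 = -i q⁻¹ μ'(0)` of the main term of the expected value, for a transducer
whose underlying digraph has exactly one final strongly connected component, this component being
aperiodic (in particular, for a transducer with a reset sequence). It is a real number. -/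
noncomputable def mainConstant [Fintype S] [DecidableEq S] (T : Transducer q S) : ℝ :=
  (-Complex.I * (q : ℂ)⁻¹ * deriv T.dominantEigenvalue 0).re

/-- `Ψ` is the periodic fluctuation in the expected value of `𝒯(n)`: it is continuous and
`1`-periodic, and
`𝔼(𝒯(n)) = e_𝒯 log_q N + Ψ(log_q N) + O(N^{-ξ} log N)` for some `ξ > 0`. -/
structure IsFluctuation [NeZero q] [Fintype S] [DecidableEq S] (T : Transducer q S)
    (Ψ : ℝ → ℝ) : Prop where
  continuous : Continuous Ψ
  periodic : Function.Periodic Ψ 1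
  expansion : ∃ ξ : ℝ, 0 < ξ ∧
    (fun N : ℕ => T.expectedValue N -
        (T.mainConstant * Real.logb q N + Ψ (Real.logb q N)))
      =O[atTop] fun N : ℕ => (N : ℝ) ^ (-ξ) * Real.log N

end Transducer

/-! Let P be the operator that sums a function over the q successors of a state. A reset word of
length l sends all states to one, so one of the q^l terms of P^l cancels in differences between
states: P^l contracts oscillations by q^l - 1 instead of q^l. Hence q - P is onto modulo constants,
and the output sum over the digits can be written as q(e + h) - Ph (Poisson equation,
`exists_eq_sub_transfer`). Perturbation of M(t) with the test vector 1 + ith shows that e is the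
main constant (`mainConstant_eq`).

Let A_s(N) be the summatory function for the starting state s. After subtraction of h(s)N it
satisfies a recursion under P with drift eN, and the contraction makes all states agree up to O(N^η)
with η < 1. So A = A_s satisfies A(N) = qA(N/q) + eN + O(N^η) with an integer quotient. The limits
f(y) of A(⌊yq^j⌋)/q^j - ejy then exist and are continuous, and Ψ(x) = f(q^x)/q^x - ex is the
fluctuation (`exists_periodic_of_abs_sub_mul_le`). It is unique because the fractional parts of
log_q N are dense.

For non-differentiability let F(y) = y(e log_q y + Ψ(log_q y)), so that F(q^m y) = q^m(F(y) + emy).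
If the lowest digits of p spell the reset word and n is the rest, then F(p+1) - F(p) = γ + (value of
n read from r), with γ independent of n (`IsFluctuation.exists_mainTerm_sub_eq`). Put n_m = ⌊q^x
q^m⌋. Difference quotients of F near q^x are then γ + (value of n_m) - e(m + l). If they converged,
the integer differences of consecutive values would tend to e, which is not an integer. -/

namespace Transducer

variable {q : ℕ} {S : Type*}

/-- The transfer operator of the underlying automaton: the sum over all successor states. -/
def transfer {E : Type*} [AddCommMonoid E] (T : Transducer q S) (g : S → E) : S → E :=
  fun s => ∑ d : Fin q, g (T.next s d)

/-! ### Contraction of oscillations and the Poisson equation -/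

section Transfer

variable {E : Type*} [NormedAddCommGroup E] (T : Transducer q S)

theorem transfer_iterate_succ (k : ℕ) (g : S → E) (s : S) :
    T.transfer^[k + 1] g s = ∑ d : Fin q, T.transfer^[k] g (T.next s d) := by
  rw [Function.iterate_succ_apply']
  rfl

theorem transfer_iterate_sub (k : ℕ) (f g : S → E) :
    T.transfer^[k] (f - g) = T.transfer^[k] f - T.transfer^[k] g := by
  induction k with
  | zero => rfl
  | succ k ih =>
    funext s
    simp only [transfer_iterate_succ, ih, Pi.sub_apply, Finset.sum_sub_distrib]

theorem transfer_iterate_add (k : ℕ) (f g : S → E) :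
    T.transfer^[k] (f + g) = T.transfer^[k] f + T.transfer^[k] g := by
  induction k with
  | zero => rfl
  | succ k ih =>
    funext s
    simp only [transfer_iterate_succ, ih, Pi.add_apply, Finset.sum_add_distrib]

theorem transfer_iterate_const (k : ℕ) (c : E) (s : S) :
    T.transfer^[k] (fun _ => c) s = q ^ k • c := by
  induction k generalizing s with
  | zero => simp
  | succ k ih => simp [transfer_iterate_succ, ih, pow_succ', mul_smul]

theorem norm_transfer_iterate_le {g : S → E} {D : ℝ} (hg : ∀ s, ‖g s‖ ≤ D) (k : ℕ) (s : S) :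
    ‖T.transfer^[k] g s‖ ≤ q ^ k * D := by
  induction k generalizing s with
  | zero => simpa using hg s
  | succ k ih =>
    rw [transfer_iterate_succ]
    refine (norm_sum_le _ _).trans ((Finset.sum_le_sum fun d _ => ih _).trans_eq ?_)
    simp [pow_succ', mul_assoc]

theorem norm_transfer_iterate_sub_le {g : S → E} {D : ℝ} (hg : ∀ s s', ‖g s - g s'‖ ≤ D)
    (k : ℕ) (s s' : S) : ‖T.transfer^[k] g s - T.transfer^[k] g s'‖ ≤ q ^ k * D := by
  induction k generalizing s s' with
  | zero => simpa using hg s s'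
  | succ k ih =>
    rw [transfer_iterate_succ, transfer_iterate_succ, ← Finset.sum_sub_distrib]
    refine (norm_sum_le _ _).trans ((Finset.sum_le_sum fun d _ => ih _ _).trans_eq ?_)
    simp [pow_succ', mul_assoc]

/-- Up to the contribution of a single word, the transfer operator contracts oscillations. -/
theorem norm_transfer_iterate_sub_sub_le {g : S → E} {D : ℝ} (hg : ∀ s s', ‖g s - g s'‖ ≤ D)
    (w : List (Fin q)) (s s' : S) :
    ‖(T.transfer^[w.length] g s - T.transfer^[w.length] g s')
      - (g (T.stateAfter s w) - g (T.stateAfter s' w))‖ ≤ (q ^ w.length - 1) * D := by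
  induction w generalizing s s' with
  | nil => simp [stateAfter]
  | cons d w ih =>
    have hw (a : S) : T.stateAfter a (d :: w) = T.stateAfter (T.next a d) w := rfl
    rw [List.length_cons, transfer_iterate_succ, transfer_iterate_succ, hw, hw,
      ← Finset.sum_sub_distrib, ← Finset.add_sum_erase _ _ (Finset.mem_univ d), add_sub_right_comm]
    have h1 : ‖∑ d' ∈ Finset.univ.erase d, (T.transfer^[w.length] g (T.next s d') -
        T.transfer^[w.length] g (T.next s' d'))‖ ≤ (q - 1) * (q ^ w.length * D) := by
      refine (norm_sum_le _ _).trans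
        ((Finset.sum_le_sum fun d _ => T.norm_transfer_iterate_sub_le hg _ _ _).trans_eq ?_)
      have : 1 ≤ q := d.pos
      simp [Finset.card_erase_of_mem, Nat.cast_sub this]
    calc _ ≤ _ := norm_add_le _ _
      _ ≤ (q ^ w.length - 1) * D + (q - 1) * (q ^ w.length * D) := add_le_add (ih _ _) h1
      _ = _ := by ring

/-- With a reset sequence of length `l`, the `l`-th power of the transfer operator contracts
oscillations by the factor `q ^ l - 1`. -/
theorem norm_transfer_iterate_sub_le_of_reset {w : List (Fin q)} {r : S}
    (hw : ∀ s, T.stateAfter s w = r) {g : S → E} {D : ℝ} (hg : ∀ s s', ‖g s - g s'‖ ≤ D)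
    (s s' : S) :
    ‖T.transfer^[w.length] g s - T.transfer^[w.length] g s'‖ ≤ (q ^ w.length - 1) * D := by
  simpa [hw] using T.norm_transfer_iterate_sub_sub_le hg w s s'

/-- At a pair of states with maximal oscillation D, the contraction gives q^l D ≤ (q^l - 1) D, so D
= 0. -/
theorem eq_of_norm_transfer_iterate_sub_eq [Finite S] {w : List (Fin q)} {r : S}
    (hw : ∀ s, T.stateAfter s w = r) {g : S → E}
    (hg : ∀ s s', ‖T.transfer^[w.length] g s - T.transfer^[w.length] g s'‖
      = q ^ w.length * ‖g s - g s'‖) (s s' : S) : g s = g s' := by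
  have : Nonempty (S × S) := ⟨(s, s')⟩
  obtain ⟨p, hp⟩ := Finite.exists_max fun p : S × S => ‖g p.1 - g p.2‖
  have h := T.norm_transfer_iterate_sub_le_of_reset hw (fun a b => hp (a, b)) p.1 p.2
  rw [hg] at h
  have h0 : ‖g p.1 - g p.2‖ ≤ 0 := by linarith
  exact sub_eq_zero.1 (norm_le_zero_iff.1 ((hp (s, s')).trans h0))

/-- For a transducer with reset sequence, `q - transfer` is onto modulo constants. -/
theorem exists_eq_sub_transfer [Fintype S] {𝕜 : Type*} [RCLike 𝕜] (hq : q ≠ 0)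
    (hreset : T.HasResetSequence) (g : S → 𝕜) :
    ∃ (e : 𝕜) (h : S → 𝕜), ∀ s, g s = q * (e + h s) - T.transfer h s := by
  obtain ⟨w, r, hw⟩ := hreset
  -- The map q - P kills constants; the extra term `h T.initial` removes this kernel. In finite
  -- dimension injectivity then gives surjectivity. On the kernel of Φ, P is multiplication by q up
  -- to a constant, so its powers scale oscillations exactly.
  let Φ : (S → 𝕜) →ₗ[𝕜] (S → 𝕜) :=
    { toFun := fun h s => h T.initial + q * h s - T.transfer h s
      map_add' := fun f g => by
        funext s
        simp only [transfer, Pi.add_apply, Finset.sum_add_distrib]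
        ring
      map_smul' := fun c f => by
        funext s
        simp only [transfer, Pi.smul_apply, smul_eq_mul, ← Finset.mul_sum, RingHom.id_apply]
        ring }
  have hΦ : Function.Injective Φ := by
    refine (injective_iff_map_eq_zero Φ).2 fun h hh => ?_
    have h1 (s : S) : T.transfer h s = q * h s + h T.initial := by
      have := congrFun hh s
      simp only [Φ, LinearMap.coe_mk, AddHom.coe_mk, Pi.zero_apply] at this
      linear_combination -this
    have h2 (k : ℕ) : ∃ c : 𝕜, ∀ s, T.transfer^[k] h s = q ^ k * h s + c := by
      induction k with
      | zero => exact ⟨0, by simp⟩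
      | succ k ih =>
        obtain ⟨c, hc⟩ := ih
        refine ⟨q ^ k * h T.initial + q * c, fun s => ?_⟩
        have := h1 s
        rw [transfer] at this
        simp only [transfer_iterate_succ, hc, Finset.sum_add_distrib, ← Finset.mul_sum, this]
        simp
        ring
    obtain ⟨c, hc⟩ := h2 w.length
    have h3 := T.eq_of_norm_transfer_iterate_sub_eq hw (g := h) fun s s' => by
      rw [hc, hc, add_sub_add_right_eq_sub, ← mul_sub, norm_mul]
      simp
    have h4 : h T.initial = 0 := by
      have := h1 T.initial
      rw [transfer, Finset.sum_congr rfl fun d _ => h3 (T.next T.initial d) T.initial] at this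
      simpa using this
    funext s
    rw [h3 s T.initial, h4, Pi.zero_apply]
  obtain ⟨h, hh⟩ := (LinearMap.injective_iff_surjective.1 hΦ) g
  refine ⟨h T.initial / q, h, fun s => ?_⟩
  rw [← hh]
  have : (q : 𝕜) ≠ 0 := Nat.cast_ne_zero.2 hq
  simp only [Φ, LinearMap.coe_mk, AddHom.coe_mk]
  field_simp

end Transfer

end Transducer

/-! ### Limits and eigenvalues of complex matrices -/

theorem tendsto_dotProduct {α S : Type*} [Fintype S] {l : Filter α} {f g : α → S → ℂ} {x y : S → ℂ}
    (hf : Tendsto f l (𝓝 x)) (hg : Tendsto g l (𝓝 y)) :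
    Tendsto (fun a => dotProduct (f a) (g a)) l (𝓝 (dotProduct x y)) :=
  tendsto_finsetSum _ fun s _ => (tendsto_pi_nhds.1 hf s).mul (tendsto_pi_nhds.1 hg s)

theorem tendsto_vecMul {α S : Type*} [Fintype S] {l : Filter α} {f : α → S → ℂ}
    {g : α → Matrix S S ℂ} {x : S → ℂ} {A : Matrix S S ℂ} (hf : Tendsto f l (𝓝 x)) (hg : Tendsto g l (𝓝 A)) :
    Tendsto (fun a => Matrix.vecMul (f a) (g a)) l (𝓝 (Matrix.vecMul x A)) :=
  tendsto_pi_nhds.2 fun s => tendsto_dotProduct hf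
    (tendsto_pi_nhds.2 fun s' => tendsto_pi_nhds.1 (tendsto_pi_nhds.1 hg s') s)

section Eigenvalues

variable {S : Type*} [Fintype S] [DecidableEq S]

theorem hasEigenvalue_toLin'_iff_det (A : Matrix S S ℂ) (z : ℂ) :
    Module.End.HasEigenvalue (Matrix.toLin' A) z ↔ (Matrix.scalar S z - A).det = 0 := by
  rw [Module.End.hasEigenvalue_iff_isRoot_charpoly, Matrix.charpoly_toLin', Polynomial.IsRoot,
    Matrix.eval_charpoly]

theorem exists_vecMul_eq_smul {A : Matrix S S ℂ} {z : ℂ}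
    (h : Module.End.HasEigenvalue (Matrix.toLin' A) z) :
    ∃ y : S → ℂ, ‖y‖ = 1 ∧ Matrix.vecMul y A = z • y := by
  obtain ⟨y, hy, hyA⟩ := Matrix.exists_vecMul_eq_zero_iff.2
    ((hasEigenvalue_toLin'_iff_det A z).1 h)
  have h1 : Matrix.vecMul y A = z • y := by
    rw [Matrix.vecMul_sub, sub_eq_zero] at hyA
    rw [← hyA]
    funext s
    simp [Matrix.scalar_apply, Matrix.vecMul_diagonal, mul_comm]
  refine ⟨((‖y‖⁻¹ : ℝ) : ℂ) • y, ?_, ?_⟩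
  · rw [norm_smul, Complex.norm_real, norm_inv, norm_norm, inv_mul_cancel₀ (norm_ne_zero_iff.2 hy)]
  · rw [Matrix.smul_vecMul, h1, smul_comm]

theorem exists_mulVec_eq_smul {A : Matrix S S ℂ} {z : ℂ}
    (h : Module.End.HasEigenvalue (Matrix.toLin' A) z) :
    ∃ v : S → ℂ, v ≠ 0 ∧ A.mulVec v = z • v := by
  obtain ⟨v, hv⟩ := h.exists_hasEigenvector
  exact ⟨v, hv.2, by simpa using hv.apply_eq_smul⟩

/-- The determinant is the product of the differences between x and the eigenvalues, each of modulus
at least `x - ‖z‖`. This turns continuity of the determinant into control of the spectral radius. -/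
theorem pow_sub_norm_le_norm_det {A : Matrix S S ℂ} {z : ℂ} (hz : IsDominantEigenvalue A z)
    {x : ℝ} (hx : ‖z‖ ≤ x) :
    (x - ‖z‖) ^ Fintype.card S ≤ ‖(Matrix.scalar S (x : ℂ) - A).det‖ := by
  have hs := IsAlgClosed.splits A.charpoly
  have hx0 : 0 ≤ x := (norm_nonneg z).trans hx
  rw [← Matrix.eval_charpoly, hs.eval_eq_prod_roots_of_monic A.charpoly_monic,
    ← Matrix.charpoly_natDegree_eq_dim A, hs.natDegree_eq_card_roots]
  have key : ∀ w ∈ A.charpoly.roots, ‖w‖ ≤ ‖z‖ := fun w hw => by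
    refine hz.2 w ?_
    rw [Module.End.hasEigenvalue_iff_isRoot_charpoly, Matrix.charpoly_toLin']
    exact (Polynomial.mem_roots'.1 hw).2
  generalize A.charpoly.roots = m at key
  induction m using Multiset.induction_on with
  | empty => simp
  | cons a m ih =>
    simp only [Multiset.card_cons, Multiset.map_cons, Multiset.prod_cons, norm_mul, pow_succ']
    have ha := key a (Multiset.mem_cons_self a m)
    refine mul_le_mul ?_ (ih fun w hw => key w (Multiset.mem_cons_of_mem hw))
      (pow_nonneg (sub_nonneg.2 hx) _) (norm_nonneg _)
    have := norm_sub_norm_le (x : ℂ) a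
    rw [Complex.norm_real, Real.norm_of_nonneg hx0] at this
    linarith

end Eigenvalues

/-! ### The dominant eigenvalue and its derivative at 0 -/

namespace Transducer

theorem continuous_transitionMatrix {q : ℕ} {S : Type*} [DecidableEq S]
    (T : Transducer q S) : Continuous T.transitionMatrix := by
  refine continuous_finsetSum _ fun d _ => continuous_matrix fun s s' => ?_
  simp only [digitMatrix, Matrix.of_apply]
  split_ifs <;> fun_prop

variable {q : ℕ} {S : Type*} [Fintype S] [DecidableEq S] (T : Transducer q S)

theorem transitionMatrix_mulVec (t : ℝ) (v : S → ℂ) (s : S) :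
    (T.transitionMatrix t).mulVec v s
      = ∑ d, Complex.exp (Complex.I * t * T.output s d) * v (T.next s d) := by
  simp only [transitionMatrix, Matrix.sum_mulVec, Finset.sum_apply]
  refine Finset.sum_congr rfl fun d _ => ?_
  simp [digitMatrix, Matrix.mulVec, dotProduct]

theorem transitionMatrix_zero_mulVec (v : S → ℂ) :
    (T.transitionMatrix 0).mulVec v = T.transfer v := by
  funext s
  simp [transitionMatrix_mulVec, transfer]

theorem isDominantEigenvalue_dominantEigenvalue (t : ℝ) :
    IsDominantEigenvalue (T.transitionMatrix t) (T.dominantEigenvalue t) :=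
  haveI : Nonempty S := ⟨T.initial⟩
  Classical.choose_spec (exists_isDominantEigenvalue (T.transitionMatrix t))

theorem norm_le_of_hasEigenvalue {t : ℝ} {z : ℂ}
    (hz : Module.End.HasEigenvalue (Matrix.toLin' (T.transitionMatrix t)) z) : ‖z‖ ≤ q := by
  obtain ⟨v, hv, hz⟩ := exists_mulVec_eq_smul hz
  have : Nonempty S := ⟨T.initial⟩
  obtain ⟨s, hs⟩ := Finite.exists_max fun s => ‖v s‖
  have hpos : 0 < ‖v s‖ := by
    obtain ⟨a, ha⟩ := Function.ne_iff.1 hv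
    exact (norm_pos_iff.2 ha).trans_le (hs a)
  refine le_of_mul_le_mul_right ?_ hpos
  have h1 := congrFun hz s
  rw [transitionMatrix_mulVec, Pi.smul_apply, smul_eq_mul] at h1
  rw [← norm_mul, ← h1]
  refine (norm_sum_le _ _).trans ((Finset.sum_le_sum fun d _ => ?_).trans_eq
    (by simp : ∑ _d : Fin q, ‖v s‖ = q * ‖v s‖))
  have : Complex.I * t * T.output s d = ((t * T.output s d : ℝ) : ℂ) * Complex.I := by
    push_cast
    ring
  rw [norm_mul, this, Complex.norm_exp_ofReal_mul_I, one_mul]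
  exact hs _

/-- An eigenvector for an eigenvalue of modulus q has its oscillations scaled exactly by powers of
q, so it is constant. -/
theorem eq_of_hasEigenvalue_of_norm_eq (hreset : T.HasResetSequence) {z : ℂ}
    (hz : Module.End.HasEigenvalue (Matrix.toLin' (T.transitionMatrix 0)) z) (hn : ‖z‖ = q) :
    z = q := by
  obtain ⟨w, r, hw⟩ := hreset
  obtain ⟨v, hv, hz⟩ := exists_mulVec_eq_smul hz
  rw [transitionMatrix_zero_mulVec] at hz
  have hk (k : ℕ) (s : S) : T.transfer^[k] v s = z ^ k * v s := by
    induction k generalizing s with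
    | zero => simp
    | succ k ih =>
      have := congrFun hz s
      rw [transfer, Pi.smul_apply, smul_eq_mul] at this
      simp only [transfer_iterate_succ, ih, ← Finset.mul_sum, this]
      ring
  have hc := T.eq_of_norm_transfer_iterate_sub_eq hw (g := v) fun s s' => by
    rw [hk, hk, ← mul_sub, norm_mul, norm_pow, hn]
  obtain ⟨a, ha⟩ := Function.ne_iff.1 hv
  have h1 := congrFun hz a
  rw [transfer, Finset.sum_congr rfl fun d _ => hc (T.next a d) a] at h1
  have h2 : (q : ℂ) * v a = z * v a := by simpa using h1
  exact (mul_right_cancel₀ ha h2).symm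

theorem hasEigenvalue_transitionMatrix_zero :
    Module.End.HasEigenvalue (Matrix.toLin' (T.transitionMatrix 0)) (q : ℂ) := by
  refine Module.End.hasEigenvalue_of_hasEigenvector (x := fun _ => 1) ⟨?_, ?_⟩
  · rw [Module.End.mem_eigenspace_iff, Matrix.toLin'_apply, transitionMatrix_zero_mulVec]
    funext s
    simp [transfer]
  · exact fun h => one_ne_zero (congrFun h T.initial)

theorem norm_dominantEigenvalue_le (t : ℝ) : ‖T.dominantEigenvalue t‖ ≤ q :=
  T.norm_le_of_hasEigenvalue (T.isDominantEigenvalue_dominantEigenvalue t).1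

theorem dominantEigenvalue_zero (hreset : T.HasResetSequence) :
    T.dominantEigenvalue 0 = q := by
  refine T.eq_of_hasEigenvalue_of_norm_eq hreset
    (T.isDominantEigenvalue_dominantEigenvalue 0).1 (le_antisymm (T.norm_dominantEigenvalue_le 0) ?_)
  simpa using (T.isDominantEigenvalue_dominantEigenvalue 0).2 _ T.hasEigenvalue_transitionMatrix_zero

theorem tendsto_norm_dominantEigenvalue :
    Tendsto (fun t => ‖T.dominantEigenvalue t‖) (𝓝 0) (𝓝 (q : ℝ)) := by
  have : Nonempty S := ⟨T.initial⟩
  have h0 : Tendsto (fun t => ‖(Matrix.scalar S ((q : ℝ) : ℂ) - T.transitionMatrix t).det‖) (𝓝 0)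
      (𝓝 0) := by
    have hc : Continuous fun t => ‖(Matrix.scalar S ((q : ℝ) : ℂ) - T.transitionMatrix t).det‖ :=
      (continuous_const.sub T.continuous_transitionMatrix).matrix_det.norm
    have := hc.tendsto 0
    rwa [Complex.ofReal_natCast,
      (hasEigenvalue_toLin'_iff_det _ _).1 T.hasEigenvalue_transitionMatrix_zero, norm_zero] at this
  have h1 : Tendsto (fun t => (q - ‖T.dominantEigenvalue t‖) ^ Fintype.card S) (𝓝 0) (𝓝 0) :=
    squeeze_zero (fun t => pow_nonneg (sub_nonneg.2 (T.norm_dominantEigenvalue_le t)) _)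
      (fun t => pow_sub_norm_le_norm_det (T.isDominantEigenvalue_dominantEigenvalue t)
        (T.norm_dominantEigenvalue_le t)) h0
  have h2 : Tendsto (fun t => q - ‖T.dominantEigenvalue t‖) (𝓝 0) (𝓝 0) := by
    rw [Metric.tendsto_nhds] at h1 ⊢
    intro ε hε
    filter_upwards [h1 _ (pow_pos hε (Fintype.card S))] with t ht
    rw [Real.dist_0_eq_abs, abs_pow] at ht
    rw [Real.dist_0_eq_abs]
    exact lt_of_pow_lt_pow_left₀ _ hε.le ht
  simpa using h2.const_sub (q : ℝ)

/-- By the Poisson equation every function is a constant plus an element of the image of q - P. The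
vector y annihilates both. -/
theorem eq_zero_of_vecMul_eq_smul (hq : q ≠ 0) (hreset : T.HasResetSequence) {y : S → ℂ}
    (hy : Matrix.vecMul y (T.transitionMatrix 0) = (q : ℂ) • y) (h1 : ∑ s, y s = 0) : y = 0 := by
  refine dotProduct_eq_zero y fun g => ?_
  obtain ⟨e, h, hg⟩ := T.exists_eq_sub_transfer hq hreset g
  have h2 : dotProduct y (T.transfer h) = q * dotProduct y h := by
    rw [← transitionMatrix_zero_mulVec, Matrix.dotProduct_mulVec, hy, smul_dotProduct, smul_eq_mul]
  have h3 : g = (fun _ => (q : ℂ) * e) + (q : ℂ) • h - T.transfer h := by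
    funext s
    rw [hg]
    simp
    ring
  rw [h3, dotProduct_sub, dotProduct_add, dotProduct_smul, h2]
  simp [dotProduct, ← Finset.sum_mul, h1]

/-- The Poisson equation says that the first-order term vanishes: 1 + ith is a right eigenvector of
M(t) for q(1 + ite) up to o(t). -/
theorem hasDerivAt_transitionMatrix_mulVec_sub {e : ℝ} {h : S → ℝ}
    (hh : ∀ s, ∑ d, T.output s d = q * (e + h s) - T.transfer h s) :
    HasDerivAt (fun t : ℝ => (T.transitionMatrix t).mulVec (fun s => 1 + Complex.I * t * h s)
      - ((q : ℂ) * (1 + Complex.I * t * e)) • fun s => 1 + Complex.I * t * h s) 0 0 := by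
  have hlin (c : ℂ) : HasDerivAt (fun t : ℝ => Complex.I * t * c) (Complex.I * c) 0 := by
    have h1 : HasDerivAt (fun t : ℝ => (t : ℂ)) 1 0 := Complex.ofRealCLM.hasDerivAt
    simpa using (h1.const_mul Complex.I).mul_const c
  rw [hasDerivAt_pi]
  intro s
  have h1 : HasDerivAt (fun t : ℝ => ∑ d, Complex.exp (Complex.I * t * T.output s d)
      * (1 + Complex.I * t * h (T.next s d)) - (q : ℂ) * (1 + Complex.I * t * e)
        * (1 + Complex.I * t * h s))
      (∑ d, (Complex.I * T.output s d + Complex.I * h (T.next s d))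
        - ((q : ℂ) * (Complex.I * e) + q * (Complex.I * h s))) 0 := by
    refine HasDerivAt.sub (HasDerivAt.fun_sum fun d _ => ?_) ?_
    · have := (hlin (T.output s d)).cexp.fun_mul ((hlin (h (T.next s d))).const_add 1)
      simpa using this
    · have := ((hlin e).const_add 1 |>.const_mul (q : ℂ)).fun_mul ((hlin (h s)).const_add 1)
      simpa using this
  have h2 : (∑ d, (Complex.I * T.output s d + Complex.I * h (T.next s d))
        - ((q : ℂ) * (Complex.I * e) + q * (Complex.I * h s))) = 0 := by
    have h3 := congrArg (fun x : ℝ => (x : ℂ)) (hh s)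
    simp only [transfer] at h3
    push_cast at h3
    rw [Finset.sum_add_distrib, ← Finset.mul_sum, ← Finset.mul_sum, h3]
    ring
  rw [h2] at h1
  refine h1.congr_of_eventuallyEq (Eventually.of_forall fun t => ?_)
  simp [transitionMatrix_mulVec]

/-- The derivative of the dominant eigenvalue at `0`, from a solution `(e, h)` of the Poisson
equation for the mean outputs. -/
theorem hasDerivAt_dominantEigenvalue (hq : q ≠ 0) (hreset : T.HasResetSequence) {e : ℝ}
    {h : S → ℝ} (hh : ∀ s, ∑ d, T.output s d = q * (e + h s) - T.transfer h s) :
    HasDerivAt T.dominantEigenvalue (Complex.I * q * e) 0 := by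
  set μ := T.dominantEigenvalue with hμ
  choose y hy1 hy using fun t => exists_vecMul_eq_smul
    (T.isDominantEigenvalue_dominantEigenvalue t).1
  let u : ℝ → S → ℂ := fun t s => 1 + Complex.I * t * h s
  let φ : ℝ → S → ℂ := fun t => (T.transitionMatrix t).mulVec (u t)
    - ((q : ℂ) * (1 + Complex.I * t * e)) • u t
  have hid (t : ℝ) : (μ t - q * (1 + Complex.I * t * e)) * dotProduct (y t) (u t)
      = dotProduct (y t) (φ t) := by
    simp only [φ]
    rw [dotProduct_sub, Matrix.dotProduct_mulVec, hy, smul_dotProduct, dotProduct_smul]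
    simp only [smul_eq_mul]
    ring
  have hφ0 : φ 0 = 0 := by
    funext s
    simp [φ, u, transitionMatrix_mulVec]
  have hφ : HasDerivAt φ 0 0 := T.hasDerivAt_transitionMatrix_mulVec_sub hh
  have hslope : Tendsto (fun t : ℝ => (t : ℂ)⁻¹ • φ t) (𝓝[≠] 0) (𝓝 0) := by
    have := hasDerivAt_iff_tendsto_slope.1 hφ
    refine this.congr fun t => ?_
    funext s
    simp [slope, hφ0]
  -- The values μ(t) and the left eigenvectors y(t) are chosen separately for each t, with no
  -- continuity. Along an ultrafilter both converge by compactness; the limit x is a left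
  -- eigenvector of M(0) for q, so its coordinate sum is nonzero and `hid` can be divided by the
  -- pairing.
  rw [hasDerivAt_iff_tendsto_slope, tendsto_iff_ultrafilter]
  intro U hU
  have hU0 : (U : Filter ℝ) ≤ 𝓝 0 := hU.trans nhdsWithin_le_nhds
  obtain ⟨z, -, hz⟩ := isCompact_iff_ultrafilter_le_nhds.1
    (isCompact_closedBall (0 : ℂ) q) (U.map μ) (by
      rw [Ultrafilter.coe_map, le_principal_iff, mem_map]
      exact univ_mem' fun t => by simpa using T.norm_dominantEigenvalue_le t)
  obtain ⟨x, hx1, hx⟩ := isCompact_iff_ultrafilter_le_nhds.1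
    (isCompact_sphere (0 : S → ℂ) 1) (U.map y) (by
      rw [Ultrafilter.coe_map, le_principal_iff, mem_map]
      exact univ_mem' fun t => by simpa using hy1 t)
  have hz : Tendsto μ U (𝓝 z) := hz
  have hx : Tendsto y U (𝓝 x) := hx
  have hM : Tendsto T.transitionMatrix U (𝓝 (T.transitionMatrix 0)) :=
    (T.continuous_transitionMatrix.tendsto 0).mono_left hU0
  have hxz : Matrix.vecMul x (T.transitionMatrix 0) = z • x := by
    have h1 : Tendsto (fun t => Matrix.vecMul (y t) (T.transitionMatrix t)) U
        (𝓝 (Matrix.vecMul x (T.transitionMatrix 0))) := tendsto_vecMul hx hM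
    simp only [hy] at h1
    exact tendsto_nhds_unique h1 (hz.smul hx)
  have hx0 : x ≠ 0 := by
    rintro rfl
    simp at hx1
  have hzq : z = q := by
    refine T.eq_of_hasEigenvalue_of_norm_eq hreset ?_
      (tendsto_nhds_unique hz.norm (T.tendsto_norm_dominantEigenvalue.mono_left hU0))
    rw [hasEigenvalue_toLin'_iff_det, ← Matrix.exists_vecMul_eq_zero_iff]
    refine ⟨x, hx0, ?_⟩
    rw [Matrix.vecMul_sub, hxz, sub_eq_zero]
    funext s
    simp [Matrix.scalar_apply, Matrix.vecMul_diagonal, mul_comm]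
  subst hzq
  have hsum : ∑ s, x s ≠ 0 := fun h => hx0 (T.eq_zero_of_vecMul_eq_smul hq hreset hxz h)
  have hdot : Tendsto (fun t => dotProduct (y t) (u t)) U (𝓝 (∑ s, x s)) := by
    have hu : Tendsto u U (𝓝 fun _ => 1) := by
      have hc : Continuous u := by fun_prop
      have := (hc.tendsto 0).mono_left hU0
      simpa [u] using this
    have := tendsto_dotProduct hx hu
    simpa [dotProduct] using this
  have hnum : Tendsto (fun t : ℝ => dotProduct (y t) ((t : ℂ)⁻¹ • φ t)) U (𝓝 0) := by
    have := tendsto_dotProduct hx (hslope.mono_left hU)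
    simpa using this
  have hlim := (hnum.div hdot hsum).const_add (Complex.I * q * e)
  rw [zero_div, add_zero] at hlim
  refine hlim.congr' ?_
  filter_upwards [hdot.eventually_ne hsum, hU self_mem_nhdsWithin] with t ht ht0
  have ht0' : (t : ℂ) ≠ 0 := Complex.ofReal_ne_zero.2 ht0
  have hs : slope μ 0 t = (t : ℂ)⁻¹ * (μ t - q) := by
    rw [slope, hμ, T.dominantEigenvalue_zero hreset]
    simp
  rw [hs, Pi.div_apply, dotProduct_smul, ← hid, smul_eq_mul]
  field_simp
  ring

theorem mainConstant_eq (hq : q ≠ 0) (hreset : T.HasResetSequence) {e : ℝ} {h : S → ℝ}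
    (hh : ∀ s, ∑ d, T.output s d = q * (e + h s) - T.transfer h s) : T.mainConstant = e := by
  rw [mainConstant, (T.hasDerivAt_dominantEigenvalue hq hreset hh).deriv]
  have : (q : ℂ) ≠ 0 := Nat.cast_ne_zero.2 hq
  have h1 : -Complex.I * (q : ℂ)⁻¹ * (Complex.I * q * e) = e := by
    field_simp
    rw [Complex.I_sq]
    ring
  rw [h1, Complex.ofReal_re]

end Transducer

/-! ### Recursions for the summatory functions -/

namespace Transducer

theorem exists_abs_outputSum_le {q : ℕ} {S : Type*} [Finite S] (T : Transducer q S) :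
    ∃ C : ℝ, 0 ≤ C ∧ ∀ s w, |T.outputSum s w| ≤ C * (w.length + 1) := by
  have : Nonempty S := ⟨T.initial⟩
  obtain ⟨C₁, h₁⟩ := (Set.finite_range fun p : S × Fin q => |T.output p.1 p.2|).bddAbove
  obtain ⟨C₂, h₂⟩ := (Set.finite_range fun s => |T.finalOutput s|).bddAbove
  have h₁' (s : S) (d : Fin q) : |T.output s d| ≤ C₁ := h₁ ⟨(s, d), rfl⟩
  have h₂' (s : S) : |T.finalOutput s| ≤ C₂ := h₂ ⟨s, rfl⟩
  refine ⟨max C₁ C₂, le_max_of_le_right ((abs_nonneg _).trans (h₂' T.initial)), fun s w => ?_⟩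
  induction w generalizing s with
  | nil => simpa [outputSum] using Or.inr (h₂' s)
  | cons d w ih =>
    rw [outputSum, List.length_cons]
    push_cast
    have h3 := abs_add_le (T.output s d) (T.outputSum (T.next s d) w)
    have h4 := ih (T.next s d)
    have h5 := (h₁' s d).trans (le_max_left C₁ C₂)
    linarith

variable {q : ℕ} [NeZero q] {S : Type*} (T : Transducer q S)

/-- The output sum for the `q`-ary expansion of `n` when it is read from the state `s`. -/
def valueFrom (s : S) (n : ℕ) : ℝ :=
  T.outputSum s (inputWord q n)

/-- The summatory function of `valueFrom`. -/
def valueSum (s : S) (N : ℕ) : ℝ :=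
  ∑ n ∈ Finset.range N, T.valueFrom s n

/-- For n = 0 and d = 0 no digit is read; this case has to be excluded. -/
theorem valueFrom_add_mul (hq : 2 ≤ q) (s : S) (d : Fin q) {n : ℕ} (hn : n ≠ 0) :
    T.valueFrom s (d + q * n) = T.output s d + T.valueFrom (T.next s d) n := by
  have : inputWord q (d + q * n) = d :: inputWord q n := by
    rw [inputWord, Nat.digits_add q (by omega) d n d.isLt (Or.inr hn), List.map_cons]
    congr 1
    ext
    simp
  rw [valueFrom, this]
  rfl

theorem exists_length_inputWord_le (hq : 2 ≤ q) {η : ℝ} (hη : 0 < η) :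
    ∃ C : ℝ, 0 ≤ C ∧ ∀ n : ℕ, ((inputWord q n).length : ℝ) + 1 ≤ C * (n + 1 : ℝ) ^ η := by
  have hlog : 0 < Real.log q := Real.log_pos (by exact_mod_cast hq)
  refine ⟨1 / (η * Real.log q) + 2, by positivity, fun n => ?_⟩
  have h1 : ((inputWord q n).length : ℝ) ≤ Nat.log q n + 1 := by
    rcases eq_or_ne n 0 with rfl | hn
    · simp [inputWord]
    · rw [inputWord, List.length_map, Nat.length_digits q n (by omega) hn]
      push_cast
      rfl
  have h2 : (Nat.log q n : ℝ) ≤ 1 / (η * Real.log q) * (n + 1 : ℝ) ^ η := by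
    calc (Nat.log q n : ℝ) ≤ Real.logb q n := Real.natLog_le_logb n q
      _ = Real.log n / Real.log q := rfl
      _ ≤ (n : ℝ) ^ η / η / Real.log q := by
        gcongr
        exact Real.log_le_rpow_div n.cast_nonneg hη
      _ = 1 / (η * Real.log q) * (n : ℝ) ^ η := by field_simp
      _ ≤ _ := by
        gcongr
        linarith
  have h3 : 1 ≤ (n + 1 : ℝ) ^ η := Real.one_le_rpow (by linarith [n.cast_nonneg (α := ℝ)]) hη.le
  linarith

theorem exists_abs_valueFrom_le [Finite S] (hq : 2 ≤ q) {η : ℝ} (hη : 0 < η) :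
    ∃ C : ℝ, 0 ≤ C ∧ ∀ s n, |T.valueFrom s n| ≤ C * (n + 1 : ℝ) ^ η := by
  obtain ⟨C, hC, h⟩ := T.exists_abs_outputSum_le
  obtain ⟨K, hK, h'⟩ := exists_length_inputWord_le hq hη
  refine ⟨C * K, mul_nonneg hC hK, fun s n => (h _ _).trans ?_⟩
  rw [mul_assoc]
  exact mul_le_mul_of_nonneg_left (h' n) hC

theorem valueSum_add (s : S) (M k : ℕ) :
    T.valueSum s (M + k) = T.valueSum s M + ∑ r ∈ Finset.range k, T.valueFrom s (M + r) :=
  Finset.sum_range_add _ _ _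

/-- The recursion is exact on every block of q numbers except the first. The last bracket is the
correction for that block. -/
theorem valueSum_mul (hq : 2 ≤ q) (s : S) {M : ℕ} (hM : 1 ≤ M) :
    T.valueSum s (q * M) = ∑ d, T.valueSum (T.next s d) M + M * ∑ d, T.output s d
      + (T.valueSum s q - ∑ d, T.valueSum (T.next s d) 1 - ∑ d, T.output s d) := by
  induction M, hM using Nat.le_induction with
  | base => simp
  | succ M hM ih =>
    have h1 : ∑ r ∈ Finset.range q, T.valueFrom s (q * M + r)
        = ∑ d, T.output s d + ∑ d, T.valueFrom (T.next s d) M := by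
      rw [Finset.sum_range, ← Finset.sum_add_distrib]
      refine Finset.sum_congr rfl fun d _ => ?_
      rw [add_comm, T.valueFrom_add_mul hq s d (by omega)]
    have h2 : ∑ d, T.valueSum (T.next s d) (M + 1)
        = ∑ d, T.valueSum (T.next s d) M + ∑ d, T.valueFrom (T.next s d) M := by
      rw [← Finset.sum_add_distrib]
      exact Finset.sum_congr rfl fun d _ => Finset.sum_range_succ _ _
    rw [mul_add_one, valueSum_add, ih, h1, h2]
    push_cast
    ring

theorem exists_abs_valueSum_sub_le [Finite S] (hq : 2 ≤ q) {η : ℝ} (hη : 0 < η) :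
    ∃ C : ℝ, 0 ≤ C ∧ ∀ s N, |T.valueSum s N - ∑ d, T.valueSum (T.next s d) (N / q)
      - (N / q : ℕ) * ∑ d, T.output s d| ≤ C * (N : ℝ) ^ η := by
  obtain ⟨C, hC, h⟩ := T.exists_abs_valueFrom_le hq hη
  let κ : S → ℝ := fun s =>
    T.valueSum s q - ∑ d, T.valueSum (T.next s d) 1 - ∑ d, T.output s d
  obtain ⟨K, hK⟩ := (Set.finite_range fun s => |κ s|).bddAbove
  have hK (s : S) : |κ s| ≤ K := hK ⟨s, rfl⟩
  have hK0 : 0 ≤ K := (abs_nonneg _).trans (hK T.initial)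
  refine ⟨q * C + K, by positivity, fun s N => ?_⟩
  rcases Nat.eq_zero_or_pos N with rfl | hN
  · simp only [valueSum, Nat.zero_div, Finset.range_zero, Finset.sum_empty, Finset.sum_const_zero,
      Nat.cast_zero, zero_mul, sub_zero, abs_zero]
    positivity
  have hN1 : (1 : ℝ) ≤ (N : ℝ) ^ η := Real.one_le_rpow (by exact_mod_cast hN) hη.le
  have h1 : |∑ r ∈ Finset.range (N % q), T.valueFrom s (q * (N / q) + r)| ≤ q * C * (N : ℝ) ^ η := by
    refine (Finset.abs_sum_le_sum_abs _ _).trans ((Finset.sum_le_sum (g := fun _ => C * (N : ℝ) ^ η)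
      fun r hr => (h s _).trans ?_).trans ?_)
    · have h2 : q * (N / q) + r + 1 ≤ N := by
        have := Nat.div_add_mod N q
        have := Finset.mem_range.1 hr
        omega
      have h3 : ((q * (N / q) + r : ℕ) + 1 : ℝ) ≤ N := by exact_mod_cast h2
      gcongr
    · rw [Finset.sum_const, Finset.card_range, nsmul_eq_mul, mul_assoc]
      have : ((N % q : ℕ) : ℝ) ≤ q := by exact_mod_cast (Nat.mod_lt N (by omega)).le
      gcongr
  have h2 : T.valueSum s N = T.valueSum s (q * (N / q))
      + ∑ r ∈ Finset.range (N % q), T.valueFrom s (q * (N / q) + r) := by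
    rw [← valueSum_add, Nat.div_add_mod]
  have h3 : |T.valueSum s (q * (N / q)) - ∑ d, T.valueSum (T.next s d) (N / q)
      - (N / q : ℕ) * ∑ d, T.output s d| ≤ K := by
    rcases Nat.eq_zero_or_pos (N / q) with h0 | h0
    · simpa [h0, valueSum] using hK0
    · rw [T.valueSum_mul hq s h0]
      convert hK s using 2
      ring
  rw [abs_le] at h1 h3 ⊢
  have h4 : K ≤ K * (N : ℝ) ^ η := le_mul_of_one_le_right hK0 hN1
  constructor <;> rw [h2] <;> linarith [h1.1, h1.2, h3.1, h3.2]

section Poisson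

variable {e : ℝ} {h : S → ℝ}

/-- Subtracting `h s * N` moves the state dependence of the mean output into the unknown; the
remaining drift `e * N` is common to all states. -/
theorem exists_abs_valueSum_sub_transfer_le [Finite S] (hq : 2 ≤ q) {η : ℝ} (hη : 0 < η)
    (hh : ∀ s, ∑ d, T.output s d = q * (e + h s) - T.transfer h s) :
    ∃ C : ℝ, 0 ≤ C ∧ ∀ N s, |(T.valueSum s N - h s * N)
      - T.transfer (fun s => T.valueSum s (N / q) - h s * (N / q : ℕ)) s - e * N|
        ≤ C * (N : ℝ) ^ η := by
  obtain ⟨C, hC, hb⟩ := T.exists_abs_valueSum_sub_le hq hη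
  obtain ⟨K, hK⟩ := (Set.finite_range fun s => |e + h s|).bddAbove
  have hK (s : S) : |e + h s| ≤ K := hK ⟨s, rfl⟩
  have hK0 : 0 ≤ K := (abs_nonneg _).trans (hK T.initial)
  refine ⟨C + K * q, by positivity, fun N s => ?_⟩
  rcases Nat.eq_zero_or_pos N with rfl | hN
  · simp only [valueSum, transfer, Nat.zero_div, Finset.range_zero, Finset.sum_empty,
      Finset.sum_const_zero, Nat.cast_zero, mul_zero, sub_zero, abs_zero]
    positivity
  have hN1 : (1 : ℝ) ≤ (N : ℝ) ^ η := Real.one_le_rpow (by exact_mod_cast hN) hη.le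
  have h1 : (T.valueSum s N - h s * N)
      - T.transfer (fun s => T.valueSum s (N / q) - h s * (N / q : ℕ)) s - e * N
      = (T.valueSum s N - ∑ d, T.valueSum (T.next s d) (N / q)
        - (N / q : ℕ) * ∑ d, T.output s d) - (e + h s) * (N % q : ℕ) := by
    have h2 : (N : ℝ) = q * (N / q : ℕ) + (N % q : ℕ) := by exact_mod_cast (Nat.div_add_mod N q).symm
    rw [hh]
    simp only [transfer, Finset.sum_sub_distrib, ← Finset.sum_mul]
    rw [h2]
    ring
  rw [h1]
  refine (abs_sub _ _).trans ?_
  rw [add_mul C]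
  refine add_le_add (hb s N) ?_
  rw [abs_mul, Nat.abs_cast]
  have h3 : ((N % q : ℕ) : ℝ) ≤ q := by exact_mod_cast (Nat.mod_lt N (by omega)).le
  calc |e + h s| * (N % q : ℕ) ≤ K * q := by gcongr; exact hK s
    _ ≤ _ := le_mul_of_one_le_right (by positivity) hN1

/-- All that matters about `c N` is its independence of the state: it cancels in differences. -/
theorem exists_abs_valueSum_sub_transfer_iterate_le [Finite S] (hq : 2 ≤ q) {η : ℝ} (hη : 0 < η)
    (hh : ∀ s, ∑ d, T.output s d = q * (e + h s) - T.transfer h s) (k : ℕ) :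
    ∃ (C : ℝ) (c : ℕ → ℝ), 0 ≤ C ∧ ∀ N s, |(T.valueSum s N - h s * N)
      - T.transfer^[k] (fun s => T.valueSum s (N / q ^ k) - h s * (N / q ^ k : ℕ)) s - c N|
        ≤ C * (N : ℝ) ^ η := by
  obtain ⟨C₁, hC₁, h₁⟩ := T.exists_abs_valueSum_sub_transfer_le hq hη hh
  induction k with
  | zero => exact ⟨0, 0, le_rfl, fun N s => by simp⟩
  | succ k ih =>
    obtain ⟨C, c, hC, hb⟩ := ih
    refine ⟨C + q ^ k * C₁, fun N => c N + q ^ k * (e * (N / q ^ k : ℕ)), by positivity,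
      fun N s => ?_⟩
    set U : ℕ → S → ℝ := fun N s => T.valueSum s N - h s * N with hU
    have h2 : ‖T.transfer^[k] (U (N / q ^ k) - T.transfer (U (N / q ^ (k + 1)))
        - fun _ => e * (N / q ^ k : ℕ)) s‖ ≤ q ^ k * (C₁ * (N : ℝ) ^ η) := by
      refine T.norm_transfer_iterate_le (fun a => ?_) k s
      have h3 := h₁ (N / q ^ k) a
      rw [Nat.div_div_eq_div_mul, ← pow_succ] at h3
      refine h3.trans ?_
      have : ((N / q ^ k : ℕ) : ℝ) ≤ N := by exact_mod_cast Nat.div_le_self _ _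
      gcongr
    rw [transfer_iterate_sub, transfer_iterate_sub, Pi.sub_apply, Pi.sub_apply,
      transfer_iterate_const, ← Function.iterate_succ_apply, Real.norm_eq_abs] at h2
    have h4 := hb N s
    have h5 := abs_add_le (U N s - T.transfer^[k] (U (N / q ^ k)) s - c N)
      (T.transfer^[k] (U (N / q ^ k)) s - T.transfer^[k + 1] (U (N / q ^ (k + 1))) s
        - q ^ k • (e * (N / q ^ k : ℕ)))
    have h6 : U N s - T.transfer^[k] (U (N / q ^ k)) s - c N
      + (T.transfer^[k] (U (N / q ^ k)) s - T.transfer^[k + 1] (U (N / q ^ (k + 1))) s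
        - q ^ k • (e * (N / q ^ k : ℕ))) = U N s - T.transfer^[k + 1] (U (N / q ^ (k + 1))) s
        - (c N + q ^ k * (e * (N / q ^ k : ℕ))) := by
      rw [nsmul_eq_mul]
      push_cast
      ring
    rw [h6] at h5
    refine h5.trans ?_
    rw [add_mul, mul_assoc]
    exact add_le_add h4 h2

/-- The summatory functions for different starting states differ by a linear function up to a
power saving. -/
theorem exists_abs_valueSum_sub_valueSum_le [Finite S] (hq : 2 ≤ q) (hreset : T.HasResetSequence)
    (hh : ∀ s, ∑ d, T.output s d = q * (e + h s) - T.transfer h s) :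
    ∃ η C : ℝ, 0 < η ∧ η < 1 ∧ 0 ≤ C ∧ ∀ N s s',
      |(T.valueSum s N - h s * N) - (T.valueSum s' N - h s' * N)| ≤ C * (N : ℝ) ^ η := by
  obtain ⟨w, r, hw⟩ : ∃ w r, w ≠ [] ∧ ∀ s, T.stateAfter s w = r := by
    obtain ⟨w, r, hw⟩ := hreset
    exact ⟨0 :: w, r, by simp, fun s => hw (T.next s 0)⟩
  obtain ⟨hw0, hw⟩ := hw
  set l := w.length with hl
  have hl0 : l ≠ 0 := by simpa [hl] using hw0
  have hQ : (2 : ℝ) ≤ (q : ℝ) ^ l := by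
    have h1 : q ≤ q ^ l := Nat.le_self_pow hl0 q
    exact_mod_cast hq.trans h1
  set Q : ℝ := (q : ℝ) ^ l with hQdef
  -- Q^η lies strictly between the contraction factor Q - 1 and Q, so the induction gains and η < 1.
  set η := Real.logb Q (Q - 1 / 2) with hη
  have hη0 : 0 < η := Real.logb_pos (by linarith) (by linarith)
  have hη1 : η < 1 := by
    rw [hη, Real.logb_lt_iff_lt_rpow (by linarith) (by linarith), Real.rpow_one]
    linarith
  have hQη : Q ^ η = Q - 1 / 2 := Real.rpow_logb (by linarith) (by linarith) (by linarith)
  obtain ⟨C₁, c, hC₁, h₁⟩ := T.exists_abs_valueSum_sub_transfer_iterate_le hq hη0 hh l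
  -- With this C, (Q - 1) C / (Q - 1/2) = C - 2 C₁, which leaves room for the errors of the two
  -- states.
  set C := 4 * C₁ * (Q - 1 / 2) with hCdef
  have hC : 0 ≤ C := by
    have : 0 ≤ Q - 1 / 2 := by linarith
    positivity
  refine ⟨η, C, hη0, hη1, hC, fun N => ?_⟩
  induction N using Nat.strong_induction_on with
  | _ N ih =>
    intro s s'
    rcases Nat.eq_zero_or_pos N with rfl | hN
    · simp only [valueSum, Finset.range_zero, Finset.sum_empty, Nat.cast_zero, mul_zero, sub_zero,
        abs_zero]
      positivity
    have hlt : N / q ^ l < N := Nat.div_lt_self hN (Nat.one_lt_pow hl0 (by omega))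
    have h2 := T.norm_transfer_iterate_sub_le_of_reset hw
      (g := fun s => T.valueSum s (N / q ^ l) - h s * (N / q ^ l : ℕ))
      (fun a b => ih (N / q ^ l) hlt a b) s s'
    rw [Real.norm_eq_abs, ← hl] at h2
    have h3 : ((N / q ^ l : ℕ) : ℝ) ^ η ≤ (N : ℝ) ^ η / (Q - 1 / 2) := by
      rw [← hQη, ← Real.div_rpow (by positivity) (by positivity)]
      have : ((N / q ^ l : ℕ) : ℝ) ≤ N / Q := by
        have := Nat.cast_div_le (α := ℝ) (m := N) (n := q ^ l)
        simpa [hQdef] using this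
      gcongr
    have h4 : (Q - 1) * (C * ((N / q ^ l : ℕ) : ℝ) ^ η)
        ≤ C * (N : ℝ) ^ η - 2 * C₁ * (N : ℝ) ^ η := by
      calc (Q - 1) * (C * ((N / q ^ l : ℕ) : ℝ) ^ η)
          ≤ (Q - 1) * (C * ((N : ℝ) ^ η / (Q - 1 / 2))) := by
            have : 0 ≤ Q - 1 := by linarith
            gcongr
        _ = _ := by
            have : Q - 1 / 2 ≠ 0 := by linarith
            rw [hCdef, mul_assoc (4 * C₁), mul_div_cancel₀ _ this]
            ring
    have h5 := h₁ N s
    have h6 := h₁ N s'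
    rw [abs_le] at h2 h5 h6 ⊢
    constructor <;> linarith [h2.1, h2.2, h5.1, h5.2, h6.1, h6.2]

/-- Since the states agree up to O(N^η), the transfer can be replaced by q times the value at s
itself, leaving a recursion for one sequence. -/
theorem exists_abs_valueSum_sub_mul_le [Finite S] (hq : 2 ≤ q) (hreset : T.HasResetSequence)
    (hh : ∀ s, ∑ d, T.output s d = q * (e + h s) - T.transfer h s) (s : S) :
    ∃ η C : ℝ, 0 < η ∧ η < 1 ∧ 0 ≤ C ∧
      (∀ N : ℕ, |T.valueSum s N - q * T.valueSum s (N / q) - e * N| ≤ C * (N : ℝ) ^ η) ∧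
      ∀ N : ℕ, |T.valueSum s (N + 1) - T.valueSum s N| ≤ C * (N + 1 : ℝ) ^ η := by
  obtain ⟨η, C₁, hη0, hη1, hC₁, h₁⟩ := T.exists_abs_valueSum_sub_valueSum_le hq hreset hh
  obtain ⟨C₂, hC₂, h₂⟩ := T.exists_abs_valueSum_sub_transfer_le hq hη0 hh
  obtain ⟨C₃, hC₃, h₃⟩ := T.exists_abs_valueFrom_le hq hη0
  refine ⟨η, C₂ + q * C₁ + |h s| * q + C₃, hη0, hη1, by positivity, fun N => ?_, fun N => ?_⟩
  · rcases Nat.eq_zero_or_pos N with rfl | hN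
    · simp only [valueSum, Nat.zero_div, Finset.range_zero, Finset.sum_empty, Nat.cast_zero,
        mul_zero, sub_zero, abs_zero]
      positivity
    have hN1 : (1 : ℝ) ≤ (N : ℝ) ^ η := Real.one_le_rpow (by exact_mod_cast hN) hη0.le
    have h4 := h₂ N s
    have h5 : |T.transfer (fun s => T.valueSum s (N / q) - h s * (N / q : ℕ)) s
        - q * (T.valueSum s (N / q) - h s * (N / q : ℕ))| ≤ q * C₁ * (N : ℝ) ^ η := by
      have h6 : q * (T.valueSum s (N / q) - h s * (N / q : ℕ))
          = ∑ _d : Fin q, (T.valueSum s (N / q) - h s * (N / q : ℕ)) := by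
        rw [Finset.sum_const, Finset.card_univ, Fintype.card_fin, nsmul_eq_mul]
      rw [h6, transfer, ← Finset.sum_sub_distrib]
      refine (Finset.abs_sum_le_sum_abs _ _).trans
        ((Finset.sum_le_sum fun d _ => h₁ (N / q) _ _).trans ?_)
      rw [Finset.sum_const, Finset.card_univ, Fintype.card_fin, nsmul_eq_mul, mul_assoc]
      have : ((N / q : ℕ) : ℝ) ≤ N := by exact_mod_cast Nat.div_le_self _ _
      gcongr
    have h7 : |h s * (N % q : ℕ)| ≤ |h s| * q * (N : ℝ) ^ η := by
      rw [abs_mul, Nat.abs_cast]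
      have h3 : ((N % q : ℕ) : ℝ) ≤ q := by exact_mod_cast (Nat.mod_lt N (by omega)).le
      calc |h s| * (N % q : ℕ) ≤ |h s| * q := by gcongr
        _ ≤ _ := le_mul_of_one_le_right (by positivity) hN1
    have h8 : (N : ℝ) = q * (N / q : ℕ) + (N % q : ℕ) := by exact_mod_cast (Nat.div_add_mod N q).symm
    have h9 : T.valueSum s N - q * T.valueSum s (N / q) - e * N
        = ((T.valueSum s N - h s * N)
          - T.transfer (fun s => T.valueSum s (N / q) - h s * (N / q : ℕ)) s - e * N)
        + (T.transfer (fun s => T.valueSum s (N / q) - h s * (N / q : ℕ)) s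
          - q * (T.valueSum s (N / q) - h s * (N / q : ℕ))) + h s * (N % q : ℕ) := by
      linear_combination h s * h8
    rw [h9]
    refine (abs_add_three _ _ _).trans ?_
    have h10 : 0 ≤ C₃ * (N : ℝ) ^ η := by positivity
    linarith
  · have h4 : T.valueSum s (N + 1) - T.valueSum s N = T.valueFrom s N := by
      rw [valueSum, Finset.sum_range_succ, valueSum, add_sub_cancel_left]
    rw [h4]
    refine (h₃ s N).trans ?_
    gcongr
    have : 0 ≤ C₂ + q * C₁ + |h s| * q := by positivity
    linarith

end Poisson

end Transducer

/-! ### Continuous profile of an almost homogeneous sequence -/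

section Delange

variable {q : ℕ} {A : ℕ → ℝ} {e η C : ℝ}

/-- The approximations, at scale `q ^ j`, of the continuous profile of the sequence `A`. -/
noncomputable def rescaled (q : ℕ) (A : ℕ → ℝ) (e : ℝ) (y : ℝ) (j : ℕ) : ℝ :=
  A ⌊y * q ^ j⌋₊ / q ^ j - e * j * y

/-- The continuous profile of the sequence `A`. -/
noncomputable def profile (q : ℕ) (A : ℕ → ℝ) (e : ℝ) (y : ℝ) : ℝ :=
  limUnder atTop (rescaled q A e y)

theorem rpow_sub_one_pow (hq : 2 ≤ q) (j : ℕ) :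
    ((q : ℝ) ^ (η - 1)) ^ j = ((q : ℝ) ^ j) ^ η / q ^ j := by
  have h0 : (0 : ℝ) < q := by positivity
  rw [Real.rpow_sub_one h0.ne', div_pow, ← Real.rpow_natCast, ← Real.rpow_mul h0.le,
    mul_comm, Real.rpow_mul h0.le, Real.rpow_natCast]

/-- The floor at scale q^j is the integer quotient by q of the floor at scale q^(j+1). Thus one step
costs the recursion error plus a rounding error, divided by q^(j+1). -/
theorem dist_rescaled_succ_le (hq : 2 ≤ q) (hη : 0 < η) (hC : 0 ≤ C)
    (hA : ∀ N : ℕ, |A N - q * A (N / q) - e * N| ≤ C * (N : ℝ) ^ η) {y : ℝ} (hy : 0 ≤ y) (j : ℕ) :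
    dist (rescaled q A e y j) (rescaled q A e y (j + 1))
      ≤ (C * q ^ η * y ^ η + |e|) * ((q : ℝ) ^ (η - 1)) ^ j := by
  have hq1 : (1 : ℝ) ≤ q := by exact_mod_cast (by omega : 1 ≤ q)
  have h0 : (0 : ℝ) < q := by linarith
  have hqj : (0 : ℝ) < q ^ j := by positivity
  set N := ⌊y * q ^ (j + 1)⌋₊ with hN
  have hdiv : ⌊y * q ^ j⌋₊ = N / q := by
    rw [hN, ← Nat.floor_div_natCast]
    rw [pow_succ, ← mul_assoc, mul_div_cancel_right₀ _ h0.ne']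
  have hNle : (N : ℝ) ≤ y * q ^ (j + 1) := Nat.floor_le (by positivity)
  have hNgt : y * q ^ (j + 1) < N + 1 := Nat.lt_floor_add_one _
  have h1 : rescaled q A e y (j + 1) - rescaled q A e y j
      = ((A N - q * A (N / q) - e * N) + e * (N - y * q ^ (j + 1))) / q ^ (j + 1) := by
    rw [rescaled, rescaled, hdiv, ← hN]
    push_cast
    field_simp
    ring
  have h2 : |e * (N - y * q ^ (j + 1))| ≤ |e| := by
    rw [abs_mul]
    exact mul_le_of_le_one_right (abs_nonneg e) (abs_le.2 ⟨by linarith, by linarith⟩)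
  have h3 : (N : ℝ) ^ η ≤ q ^ η * y ^ η * ((q : ℝ) ^ j) ^ η := by
    rw [← Real.mul_rpow h0.le hy, ← Real.mul_rpow (by positivity) hqj.le]
    refine Real.rpow_le_rpow (by positivity) (hNle.trans_eq ?_) hη.le
    ring
  have h4 : (1 : ℝ) ≤ ((q : ℝ) ^ j) ^ η := Real.one_le_rpow (one_le_pow₀ hq1) hη.le
  rw [dist_comm, Real.dist_eq, h1, abs_div, abs_of_pos (by positivity : (0 : ℝ) < q ^ (j + 1)),
    rpow_sub_one_pow hq, ← mul_div_assoc]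
  refine div_le_div₀ (by positivity) ?_ hqj (pow_le_pow_right₀ hq1 j.le_succ)
  refine (abs_add_le _ _).trans ?_
  rw [add_mul]
  refine add_le_add ((hA N).trans ?_) (h2.trans (le_mul_of_one_le_right (abs_nonneg e) h4))
  calc C * (N : ℝ) ^ η ≤ C * (q ^ η * y ^ η * ((q : ℝ) ^ j) ^ η) := by gcongr
    _ = _ := by ring

theorem rpow_sub_one_lt_one (hq : 2 ≤ q) (hη1 : η < 1) : (q : ℝ) ^ (η - 1) < 1 :=
  Real.rpow_lt_one_of_one_lt_of_neg (by exact_mod_cast (by omega : 1 < q)) (by linarith)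

theorem tendsto_rescaled (hq : 2 ≤ q) (hη : 0 < η) (hη1 : η < 1) (hC : 0 ≤ C)
    (hA : ∀ N : ℕ, |A N - q * A (N / q) - e * N| ≤ C * (N : ℝ) ^ η) {y : ℝ} (hy : 0 ≤ y) :
    Tendsto (rescaled q A e y) atTop (𝓝 (profile q A e y)) :=
  (cauchySeq_of_le_geometric _ _ (rpow_sub_one_lt_one hq hη1)
    (dist_rescaled_succ_le hq hη hC hA hy)).tendsto_limUnder

theorem abs_rescaled_sub_profile_le (hq : 2 ≤ q) (hη : 0 < η) (hη1 : η < 1) (hC : 0 ≤ C)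
    (hA : ∀ N : ℕ, |A N - q * A (N / q) - e * N| ≤ C * (N : ℝ) ^ η) {y : ℝ} (hy : 0 ≤ y) (j : ℕ) :
    |rescaled q A e y j - profile q A e y|
      ≤ (C * q ^ η * y ^ η + |e|) * ((q : ℝ) ^ (η - 1)) ^ j / (1 - (q : ℝ) ^ (η - 1)) :=
  dist_le_of_le_geometric_of_tendsto _ _ (rpow_sub_one_lt_one hq hη1)
    (dist_rescaled_succ_le hq hη hC hA hy) (tendsto_rescaled hq hη hη1 hC hA hy) j

theorem profile_mul (hq : 2 ≤ q) (hη : 0 < η) (hη1 : η < 1) (hC : 0 ≤ C)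
    (hA : ∀ N : ℕ, |A N - q * A (N / q) - e * N| ≤ C * (N : ℝ) ^ η) {y : ℝ} (hy : 0 ≤ y) :
    profile q A e (q * y) = q * profile q A e y + e * (q * y) := by
  have hq0 : (q : ℝ) ≠ 0 := by positivity
  have h1 := tendsto_rescaled hq hη hη1 hC hA (by positivity : 0 ≤ q * y)
  have h2 := (((tendsto_rescaled hq hη hη1 hC hA hy).comp (tendsto_add_atTop_nat 1)).const_mul
    (q : ℝ)).add_const (e * (q * y))
  refine tendsto_nhds_unique h1 (h2.congr fun j => ?_)
  simp only [Function.comp_apply, rescaled]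
  rw [show (q : ℝ) * y * q ^ j = y * q ^ (j + 1) by ring]
  push_cast
  field_simp
  ring

theorem abs_floor_sub_floor_le (hη : 0 < η) (hC : 0 ≤ C)
    (hA : ∀ N : ℕ, |A (N + 1) - A N| ≤ C * (N + 1 : ℝ) ^ η) {x x' X : ℝ} (hx : 0 ≤ x) (hx' : 0 ≤ x')
    (hX : x ≤ X) (hX' : x' ≤ X) (hd : |x - x'| ≤ 1) : |A ⌊x⌋₊ - A ⌊x'⌋₊| ≤ C * X ^ η := by
  wlog hle : x ≤ x' generalizing x x'
  · rw [abs_sub_comm]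
    exact this hx' hx hX' hX (by rwa [abs_sub_comm]) (le_of_not_ge hle)
  have h1 : ⌊x⌋₊ ≤ ⌊x'⌋₊ := Nat.floor_le_floor hle
  have h2 : ⌊x'⌋₊ ≤ ⌊x⌋₊ + 1 := by
    rw [← Nat.floor_add_one hx]
    exact Nat.floor_le_floor (by linarith [(abs_le.1 hd).1])
  rcases Nat.lt_or_ge ⌊x⌋₊ ⌊x'⌋₊ with h3 | h3
  · have h4 : ⌊x'⌋₊ = ⌊x⌋₊ + 1 := by omega
    rw [h4, abs_sub_comm]
    refine (hA _).trans ?_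
    have h5 : ((⌊x⌋₊ : ℝ) + 1) ≤ X := by
      have : ((⌊x'⌋₊ : ℕ) : ℝ) ≤ x' := Nat.floor_le hx'
      rw [h4] at this
      push_cast at this
      linarith
    gcongr
  · rw [le_antisymm h1 h3, sub_self, abs_zero]
    have : 0 ≤ X := hx.trans hX
    positivity

theorem continuousAt_profile (hq : 2 ≤ q) (hη : 0 < η) (hη1 : η < 1) (hC : 0 ≤ C)
    (hA : ∀ N : ℕ, |A N - q * A (N / q) - e * N| ≤ C * (N : ℝ) ^ η)
    (hA' : ∀ N : ℕ, |A (N + 1) - A N| ≤ C * (N + 1 : ℝ) ^ η) {y : ℝ} (hy : 0 < y) :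
    ContinuousAt (profile q A e) y := by
  have hq1 : (1 : ℝ) ≤ q := by exact_mod_cast (by omega : 1 ≤ q)
  have h0 : (0 : ℝ) < q := by linarith
  set θ := (q : ℝ) ^ (η - 1) with hθ
  have hθ1 : θ < 1 := rpow_sub_one_lt_one hq hη1
  have hθ0 : 0 < θ := by positivity
  set Y := y + 1
  set B := (C * q ^ η * Y ^ η + |e|) / (1 - θ) with hB
  have hB0 : 0 ≤ B := by
    have : 0 < 1 - θ := by linarith
    positivity
  set K := 2 * B + C * Y ^ η + |e| + 1 with hK
  have hK0 : 0 < K := by positivity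
  rw [Metric.continuousAt_iff]
  intro ε hε
  obtain ⟨j, hj⟩ := exists_pow_lt_of_lt_one (div_pos hε hK0) hθ1
  have hqj : (0 : ℝ) < q ^ j := by positivity
  -- The bounds 1 and y keep z in [0, Y]. The last one makes the arguments of the two floors differ
  -- by at most 1; its factor j + 1 also controls the term `e * j * y`.
  refine ⟨min (min 1 y) (1 / (q ^ j * (j + 1))), by positivity, fun {z} hz => ?_⟩
  have hz1 : |z - y| < 1 := hz.trans_le ((min_le_left _ _).trans (min_le_left _ _))
  have hz2 : |z - y| < y := hz.trans_le ((min_le_left _ _).trans (min_le_right _ _))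
  have hz3 : |z - y| < 1 / (q ^ j * (j + 1)) := hz.trans_le (min_le_right _ _)
  rw [lt_div_iff₀ (by positivity)] at hz3
  have hz0 : 0 ≤ z := by linarith [(abs_lt.1 hz2).1]
  have hzY : z ≤ Y := by
    have := (abs_lt.1 hz1).2
    simp only [Y]
    linarith
  have hyY : y ≤ Y := by simp [Y]
  have hgeom {x : ℝ} (hx : 0 ≤ x) (hxY : x ≤ Y) :
      |rescaled q A e x j - profile q A e x| ≤ B * θ ^ j := by
    refine (abs_rescaled_sub_profile_le hq hη hη1 hC hA hx j).trans ?_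
    rw [hB, div_mul_eq_mul_div]
    have : 0 < 1 - θ := by linarith
    gcongr
  have h1 := hgeom hz0 hzY
  have h2 := hgeom hy.le hyY
  have h3 : |A ⌊z * q ^ j⌋₊ - A ⌊y * q ^ j⌋₊| ≤ C * (Y * q ^ j) ^ η := by
    refine abs_floor_sub_floor_le hη hC hA' (by positivity) (by positivity) (by gcongr) (by gcongr) ?_
    rw [← sub_mul, abs_mul, abs_of_pos hqj]
    have : 0 ≤ |z - y| * q ^ j * j := by positivity
    nlinarith
  have h4 : |rescaled q A e z j - rescaled q A e y j| ≤ (C * Y ^ η + |e|) * θ ^ j := by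
    have h5 : rescaled q A e z j - rescaled q A e y j
        = ((A ⌊z * q ^ j⌋₊ - A ⌊y * q ^ j⌋₊) - e * (j * ((z - y) * q ^ j))) / q ^ j := by
      rw [rescaled, rescaled]
      field_simp
      ring
    have h6 : |e * (j * ((z - y) * q ^ j))| ≤ |e| := by
      rw [abs_mul, abs_mul, abs_mul, abs_of_pos hqj, Nat.abs_cast]
      refine mul_le_of_le_one_right (abs_nonneg e) ?_
      have : 0 ≤ |z - y| * q ^ j := by positivity
      nlinarith
    have h7 : (1 : ℝ) ≤ ((q : ℝ) ^ j) ^ η := Real.one_le_rpow (one_le_pow₀ hq1) hη.le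
    rw [h5, abs_div, abs_of_pos hqj, hθ, rpow_sub_one_pow hq, ← mul_div_assoc]
    refine div_le_div_of_nonneg_right ((abs_sub _ _).trans ?_) hqj.le
    rw [add_mul]
    refine add_le_add (h3.trans_eq ?_) (h6.trans (le_mul_of_one_le_right (abs_nonneg e) h7))
    rw [Real.mul_rpow (by positivity) hqj.le, mul_assoc]
  rw [lt_div_iff₀ hK0] at hj
  have h8 : 0 < θ ^ j := by positivity
  rw [Real.dist_eq]
  have h9 : |profile q A e z - profile q A e y| ≤ (2 * B + (C * Y ^ η + |e|)) * θ ^ j := by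
    rw [abs_le] at h1 h2 h4 ⊢
    constructor <;> linarith [h1.1, h1.2, h2.1, h2.2, h4.1, h4.2]
  refine h9.trans_lt (lt_of_lt_of_le ?_ (le_of_lt hj))
  rw [hK]
  linarith

/-- A sequence that almost satisfies `A N = q * A (N / q) + e * N` has an asymptotic expansion with
a continuous periodic fluctuation. -/
theorem exists_periodic_of_abs_sub_mul_le (hq : 2 ≤ q) (hη : 0 < η) (hη1 : η < 1) (hC : 0 ≤ C)
    (hA : ∀ N : ℕ, |A N - q * A (N / q) - e * N| ≤ C * (N : ℝ) ^ η)
    (hA' : ∀ N : ℕ, |A (N + 1) - A N| ≤ C * (N + 1 : ℝ) ^ η) :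
    ∃ Ψ : ℝ → ℝ, Continuous Ψ ∧ Function.Periodic Ψ 1 ∧ ∃ K : ℝ, ∀ N : ℕ, 1 ≤ N →
      |A N - N * (e * Real.logb q N + Ψ (Real.logb q N))| ≤ K * (N : ℝ) ^ η := by
  have hq1 : (1 : ℝ) < q := by exact_mod_cast (by omega : 1 < q)
  have h0 : (0 : ℝ) < q := by linarith
  refine ⟨fun x => profile q A e ((q : ℝ) ^ x) / (q : ℝ) ^ x - e * x, ?_, fun x => ?_,
    (C * q ^ η + |e|) / (1 - (q : ℝ) ^ (η - 1)), fun N hN => ?_⟩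
  · refine continuous_iff_continuousAt.2 fun x => ?_
    have h1 : ContinuousAt (fun x : ℝ => (q : ℝ) ^ x) x :=
      (Real.continuous_const_rpow h0.ne').continuousAt
    have h2 : 0 < (q : ℝ) ^ x := by positivity
    exact (((continuousAt_profile hq hη hη1 hC hA hA' h2).comp
      (f := fun x : ℝ => (q : ℝ) ^ x) h1).div h1 h2.ne').sub
      (continuousAt_const.mul continuousAt_id)
  · have h2 : 0 < (q : ℝ) ^ x := by positivity
    simp only
    rw [Real.rpow_add_one h0.ne', mul_comm _ (q : ℝ), profile_mul hq hη hη1 hC hA h2.le]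
    field_simp
    ring
  · have hN0 : (0 : ℝ) < N := by exact_mod_cast hN
    have hN1 : (1 : ℝ) ≤ (N : ℝ) ^ η := Real.one_le_rpow (by exact_mod_cast hN) hη.le
    -- At j = 0 the approximation at y = N is A N itself, so the bound for the tail is already the
    -- expansion.
    have h1 := abs_rescaled_sub_profile_le hq hη hη1 hC hA hN0.le 0
    have h2 : rescaled q A e N 0 = A N := by simp [rescaled]
    simp only
    rw [Real.rpow_logb h0 hq1.ne' hN0]
    have h3 : (N : ℝ) * (e * Real.logb q N + (profile q A e N / N - e * Real.logb q N))
        = profile q A e N := by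
      field_simp
      ring
    rw [h3, ← h2]
    refine h1.trans ?_
    rw [pow_zero, mul_one, div_mul_eq_mul_div]
    have : 0 < 1 - (q : ℝ) ^ (η - 1) := sub_pos.2 (rpow_sub_one_lt_one hq hη1)
    gcongr
    rw [add_mul]
    gcongr
    exact le_mul_of_one_le_right (abs_nonneg e) hN1

end Delange

/-- Difference quotients over intervals that are comparable to their distance from the base point
converge to the derivative. -/
theorem HasDerivAt.tendsto_div_of_abs_sub_le {f : ℝ → ℝ} {f' y₀ K : ℝ} (hf : HasDerivAt f f' y₀)
    {a b ε : ℕ → ℝ} (hε : Tendsto ε atTop (𝓝 0)) (hε0 : ∀ m, 0 < ε m)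
    (ha : ∀ m, |a m - y₀| ≤ K * ε m) (hab : ∀ m, b m = a m + ε m) :
    Tendsto (fun m => (f (b m) - f (a m)) / ε m) atTop (𝓝 f') := by
  have key {c : ℕ → ℝ} {L : ℝ} (hc : ∀ m, |c m - y₀| ≤ L * ε m) :
      (fun m => f (c m) - f y₀ - (c m - y₀) * f') =o[atTop] ε := by
    have h1 : (fun m => c m - y₀) =O[atTop] ε :=
      IsBigO.of_bound L (Eventually.of_forall fun m => by
        simpa [abs_of_pos (hε0 m)] using hc m)
    have h2 : Tendsto c atTop (𝓝 y₀) := tendsto_sub_nhds_zero_iff.1 (h1.trans_tendsto hε)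
    have h3 := (hasDerivAt_iff_isLittleO.1 hf).comp_tendsto h2
    exact h3.trans_isBigO h1
  have hb (m : ℕ) : |b m - y₀| ≤ (K + 1) * ε m := by
    have h1 := ha m
    have h2 := hε0 m
    rw [hab]
    rw [abs_le] at h1 ⊢
    constructor <;> linarith [h1.1, h1.2]
  have h := ((key hb).sub (key ha)).tendsto_div_nhds_zero.add_const f'
  rw [zero_add] at h
  refine h.congr fun m => ?_
  have := (hε0 m).ne'
  rw [hab]
  field_simp
  ring

/-! ### Sums over q-adic blocks and the main term -/

namespace Transducer

variable {q : ℕ}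

section Path

variable {S : Type*} (T : Transducer q S)

/-- The sum of the transition outputs when an input word is read from the state `s`. -/
def pathOutput : S → List (Fin q) → ℝ
  | _, [] => 0
  | s, d :: w => T.output s d + pathOutput (T.next s d) w

theorem exists_int_eq_outputSum (hint : T.HasIntegerOutput) (s : S) (w : List (Fin q)) :
    ∃ k : ℤ, T.outputSum s w = k := by
  induction w generalizing s with
  | nil => exact hint.2 s
  | cons d w ih =>
    obtain ⟨k, hk⟩ := ih (T.next s d)
    obtain ⟨l, hl⟩ := hint.1 s d
    exact ⟨l + k, by rw [outputSum, hk, hl, Int.cast_add]⟩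

theorem valueFrom_ofDigits_add [NeZero q] (hq : 2 ≤ q) (w : List (Fin q)) (s : S) {n : ℕ}
    (hn : n ≠ 0) :
    T.valueFrom s (Nat.ofDigits q (w.map Fin.val) + q ^ w.length * n)
      = T.pathOutput s w + T.valueFrom (T.stateAfter s w) n := by
  induction w generalizing s with
  | nil => simp [pathOutput, stateAfter]
  | cons d w ih =>
    have h1 : Nat.ofDigits q ((d :: w).map Fin.val) + q ^ (d :: w).length * n
        = d + q * (Nat.ofDigits q (w.map Fin.val) + q ^ w.length * n) := by
      rw [List.map_cons, Nat.ofDigits_cons, List.length_cons]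
      ring
    have h2 : Nat.ofDigits q (w.map Fin.val) + q ^ w.length * n ≠ 0 := by
      have : 0 < q ^ w.length * n := by positivity
      omega
    rw [h1, T.valueFrom_add_mul hq s d h2, ih, pathOutput, add_assoc]
    rfl

/-- The sum of all values over a `q`-adic block. -/
theorem valueSum_block [NeZero q] (hq : 2 ≤ q) {e : ℝ} {h : S → ℝ}
    (hh : ∀ s, ∑ d, T.output s d = q * (e + h s) - T.transfer h s) {p : ℕ} (hp : 1 ≤ p) (j : ℕ)
    (s : S) :
    T.valueSum s (q ^ j * (p + 1)) - T.valueSum s (q ^ j * p)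
      = q ^ j * (h s + e * j) + T.transfer^[j] (fun s => T.valueFrom s p - h s) s := by
  induction j generalizing s with
  | zero => simp [valueSum, Finset.sum_range_succ]
  | succ j ih =>
    have hpos : 1 ≤ q ^ j * p := Nat.succ_le_of_lt (by positivity)
    have hpos' : 1 ≤ q ^ j * (p + 1) := Nat.succ_le_of_lt (by positivity)
    rw [pow_succ', mul_assoc, mul_assoc, T.valueSum_mul hq s hpos, T.valueSum_mul hq s hpos',
      transfer_iterate_succ]
    have h1 : ∑ d, T.valueSum (T.next s d) (q ^ j * (p + 1))
        = ∑ d, T.valueSum (T.next s d) (q ^ j * p) + (q ^ j * (T.transfer h s + q * (e * j))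
          + ∑ d, T.transfer^[j] (fun s => T.valueFrom s p - h s) (T.next s d)) := by
      rw [← sub_eq_iff_eq_add', ← Finset.sum_sub_distrib, Finset.sum_congr rfl fun d _ => ih _,
        Finset.sum_add_distrib, ← Finset.mul_sum, Finset.sum_add_distrib]
      simp [transfer]
    -- The Poisson equation cancels `T.transfer h s` and raises the coefficient of e from j to j +
    -- 1.
    rw [h1, hh]
    push_cast
    ring

theorem expectedValue_eq [NeZero q] (N : ℕ) :
    T.expectedValue N = T.valueSum T.initial N / N :=
  rfl

end Path

/-- The smooth version of the main terms of the summatory function. -/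
noncomputable def mainTerm (q : ℕ) (e : ℝ) (Ψ : ℝ → ℝ) (y : ℝ) : ℝ :=
  y * (e * Real.logb q y + Ψ (Real.logb q y))

theorem mainTerm_pow_mul (hq : 2 ≤ q) (e : ℝ) {Ψ : ℝ → ℝ} (hΨ : Function.Periodic Ψ 1) {y : ℝ}
    (hy : 0 < y) (m : ℕ) : mainTerm q e Ψ (q ^ m * y) = q ^ m * (mainTerm q e Ψ y + e * m * y) := by
  have hq1 : (1 : ℝ) < q := by exact_mod_cast (by omega : 1 < q)
  have h1 : Real.logb q (q ^ m * y) = Real.logb q y + m := by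
    rw [Real.logb_mul (by positivity) hy.ne', Real.logb_pow, Real.logb_self_eq_one hq1, mul_one,
      add_comm]
  have h2 := hΨ.nat_mul m (Real.logb q y)
  rw [mul_one] at h2
  rw [mainTerm, mainTerm, h1, h2]
  ring

/-! ### Existence, uniqueness and non-differentiability -/

section Fluctuation

variable [NeZero q] {S : Type*} [Fintype S] [DecidableEq S] {T : Transducer q S} {Ψ : ℝ → ℝ}

theorem exists_isFluctuation (hq : 2 ≤ q) (hreset : T.HasResetSequence) :
    ∃ Ψ : ℝ → ℝ, T.IsFluctuation Ψ := by
  have hq0 : q ≠ 0 := NeZero.ne q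
  obtain ⟨e, h, hh⟩ := T.exists_eq_sub_transfer (𝕜 := ℝ) hq0 hreset fun s => ∑ d, T.output s d
  obtain ⟨η, C, hη, hη1, hC, h1, h2⟩ := T.exists_abs_valueSum_sub_mul_le hq hreset hh T.initial
  obtain ⟨Ψ, hc, hp, K, hK⟩ := exists_periodic_of_abs_sub_mul_le hq hη hη1 hC h1 h2
  refine ⟨Ψ, hc, hp, 1 - η, by linarith, IsBigO.of_bound K ?_⟩
  filter_upwards [eventually_ge_atTop 3] with N hN
  have hN3 : (3 : ℝ) ≤ N := by exact_mod_cast hN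
  have hN0 : (0 : ℝ) < N := by linarith
  have hlog : 1 ≤ Real.log N := by
    rw [Real.le_log_iff_exp_le hN0]
    linarith [Real.exp_one_lt_d9]
  have hb := hK N (by omega)
  have hK0 : 0 ≤ K := nonneg_of_mul_nonneg_left ((abs_nonneg _).trans hb) (by positivity)
  have h3 : T.valueSum T.initial N / N - (e * Real.logb q N + Ψ (Real.logb q N))
      = (T.valueSum T.initial N - N * (e * Real.logb q N + Ψ (Real.logb q N))) / N := by
    field_simp
  rw [expectedValue_eq, T.mainConstant_eq hq0 hreset hh, h3, Real.norm_eq_abs, abs_div,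
    abs_of_pos hN0, Real.norm_of_nonneg (by positivity), neg_sub, Real.rpow_sub_one hN0.ne']
  calc _ ≤ K * (N : ℝ) ^ η / N := by gcongr
    _ = K * ((N : ℝ) ^ η / N) := by ring
    _ ≤ _ := by
      gcongr
      exact le_mul_of_one_le_right (by positivity) hlog

theorem IsFluctuation.tendsto_sub (hΨ : T.IsFluctuation Ψ) :
    Tendsto (fun N : ℕ => T.expectedValue N -
      (T.mainConstant * Real.logb q N + Ψ (Real.logb q N))) atTop (𝓝 0) := by
  obtain ⟨ξ, hξ, h⟩ := hΨ.expansion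
  refine h.trans_tendsto ?_
  have h1 := (isLittleO_log_rpow_atTop hξ).tendsto_div_nhds_zero.comp
    (tendsto_natCast_atTop_atTop (R := ℝ))
  refine h1.congr fun N => ?_
  simp only [Function.comp_apply]
  rw [Real.rpow_neg N.cast_nonneg, div_eq_inv_mul]

/-- For N = ⌊q^x q^k⌋ the numbers log_q N - k tend to x, so periodicity and continuity carry the
vanishing difference at infinity back to x. -/
theorem IsFluctuation.eq (hq : 2 ≤ q) {Ψ₁ Ψ₂ : ℝ → ℝ} (h₁ : T.IsFluctuation Ψ₁)
    (h₂ : T.IsFluctuation Ψ₂) : Ψ₁ = Ψ₂ := by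
  have hq1 : (1 : ℝ) < q := by exact_mod_cast (by omega : 1 < q)
  have h0 : (0 : ℝ) < q := by linarith
  have hd : Tendsto (fun N : ℕ => Ψ₁ (Real.logb q N) - Ψ₂ (Real.logb q N)) atTop (𝓝 0) := by
    have := h₂.tendsto_sub.sub h₁.tendsto_sub
    rw [sub_zero] at this
    exact this.congr fun N => by ring
  funext x
  have hx : 0 < (q : ℝ) ^ x := by positivity
  have hpow : Tendsto (fun k : ℕ => (q : ℝ) ^ k) atTop atTop := tendsto_pow_atTop_atTop_of_one_lt hq1
  let N : ℕ → ℕ := fun k => ⌊(q : ℝ) ^ x * q ^ k⌋₊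
  have hN : Tendsto N atTop atTop := tendsto_nat_floor_atTop.comp (hpow.const_mul_atTop hx)
  have hlim : Tendsto (fun k => Real.logb q (N k) - k) atTop (𝓝 x) := by
    have h1 : Tendsto (fun k => (N k : ℝ) / q ^ k) atTop (𝓝 ((q : ℝ) ^ x)) :=
      (tendsto_nat_floor_mul_div_atTop hx.le).comp hpow
    have h2 : Tendsto (fun k => Real.logb q ((N k : ℝ) / q ^ k)) atTop (𝓝 x) := by
      have := (Real.continuousAt_logb (b := q) hx.ne').tendsto.comp h1
      rwa [Real.logb_rpow h0 hq1.ne'] at this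
    refine h2.congr' ?_
    filter_upwards [hN.eventually_gt_atTop 0] with k hk
    rw [Real.logb_div (by positivity) (by positivity), Real.logb_pow, Real.logb_self_eq_one hq1,
      mul_one]
  have h3 : Tendsto (fun k => Ψ₁ (Real.logb q (N k) - k) - Ψ₂ (Real.logb q (N k) - k)) atTop
      (𝓝 (Ψ₁ x - Ψ₂ x)) :=
    ((h₁.continuous.tendsto x).comp hlim).sub ((h₂.continuous.tendsto x).comp hlim)
  have h4 : Tendsto (fun k => Ψ₁ (Real.logb q (N k) - k) - Ψ₂ (Real.logb q (N k) - k)) atTop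
      (𝓝 0) := by
    refine (hd.comp hN).congr fun k => ?_
    have e₁ := h₁.periodic.sub_nat_mul_eq (x := Real.logb q (N k)) k
    have e₂ := h₂.periodic.sub_nat_mul_eq (x := Real.logb q (N k)) k
    rw [mul_one] at e₁ e₂
    rw [e₁, e₂]
    rfl
  exact sub_eq_zero.1 (tendsto_nhds_unique h3 h4)

/-- Along N = q^j p the o(1) error of the mean survives division by q^j, so the main term at p is
recovered exactly in the limit. -/
theorem IsFluctuation.tendsto_valueSum (hq : 2 ≤ q) (hΨ : T.IsFluctuation Ψ) {p : ℕ} (hp : 1 ≤ p) :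
    Tendsto (fun j : ℕ => T.valueSum T.initial (q ^ j * p) / q ^ j - T.mainConstant * j * p) atTop
      (𝓝 (mainTerm q T.mainConstant Ψ p)) := by
  have hp0 : (0 : ℝ) < p := by exact_mod_cast hp
  have hN : Tendsto (fun j : ℕ => q ^ j * p) atTop atTop :=
    tendsto_atTop_mono (fun j => Nat.le_mul_of_pos_right _ hp)
      (tendsto_pow_atTop_atTop_of_one_lt (by omega : 1 < q))
  have h1 := ((hΨ.tendsto_sub.comp hN).const_mul (p : ℝ)).add_const
    (mainTerm q T.mainConstant Ψ p)
  rw [mul_zero, zero_add] at h1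
  refine h1.congr fun j => ?_
  have h2 := mainTerm_pow_mul hq T.mainConstant hΨ.periodic hp0 j
  rw [mainTerm] at h2
  have hq0 : (0 : ℝ) < q ^ j := by positivity
  simp only [Function.comp_apply, expectedValue_eq]
  push_cast
  have h3 : T.mainConstant * Real.logb q (q ^ j * p) + Ψ (Real.logb q (q ^ j * p))
      = (mainTerm q T.mainConstant Ψ p + T.mainConstant * j * p) / p := by
    rw [eq_div_iff hp0.ne']
    refine mul_left_cancel₀ hq0.ne' ?_
    rw [← h2]
    ring
  rw [h3]
  field_simp
  ring

/-- The increments of the main term over blocks whose lower digits form a reset sequence. -/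
theorem IsFluctuation.exists_mainTerm_sub_eq (hq : 2 ≤ q) (hΨ : T.IsFluctuation Ψ)
    (hreset : T.HasResetSequence) :
    ∃ (v l : ℕ) (r : S) (γ : ℝ), ∀ n : ℕ, 1 ≤ n →
      mainTerm q T.mainConstant Ψ ((v + q ^ l * n : ℕ) + 1)
        - mainTerm q T.mainConstant Ψ (v + q ^ l * n : ℕ) = γ + T.valueFrom r n := by
  have hq0 : q ≠ 0 := NeZero.ne q
  obtain ⟨e, h, hh⟩ := T.exists_eq_sub_transfer (𝕜 := ℝ) hq0 hreset fun s => ∑ d, T.output s d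
  have he := T.mainConstant_eq hq0 hreset hh
  obtain ⟨w, r, hw⟩ := hreset
  set v := Nat.ofDigits q (w.map Fin.val) with hv
  set l := w.length with hl
  let f := mainTerm q T.mainConstant Ψ
  -- The sequence does not involve n: after the reset word the contribution of n is the same
  -- constant for every state. Comparing its limits for n and for 1 gives γ.
  have key (n : ℕ) (hn : 1 ≤ n) :
      Tendsto (fun j => T.transfer^[j] (fun s => T.pathOutput s w - h s) T.initial / q ^ j) atTop
        (𝓝 (f ((v + q ^ l * n : ℕ) + 1) - f (v + q ^ l * n : ℕ) - h T.initial
          - T.valueFrom r n)) := by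
    have hp : 1 ≤ v + q ^ l * n := by
      have : 0 < q ^ l * n := by positivity
      omega
    have h1 := hΨ.tendsto_valueSum hq hp
    have h2 := hΨ.tendsto_valueSum hq (p := v + q ^ l * n + 1) (by omega)
    rw [Nat.cast_add_one] at h2
    have h3 := ((h2.sub h1).sub_const (h T.initial)).sub_const (T.valueFrom r n)
    refine h3.congr fun j => ?_
    have hqj : (q : ℝ) ^ j ≠ 0 := by positivity
    have h4 := T.valueSum_block hq hh hp j T.initial
    have h5 : (fun s => T.valueFrom s (v + q ^ l * n) - h s)
        = (fun s => T.pathOutput s w - h s) + fun _ => T.valueFrom r n := by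
      funext s
      rw [hv, hl, T.valueFrom_ofDigits_add hq w s (by omega), hw, Pi.add_apply]
      ring
    rw [h5, transfer_iterate_add, Pi.add_apply, transfer_iterate_const, nsmul_eq_mul] at h4
    rw [he]
    push_cast at h4 ⊢
    field_simp
    linear_combination h4
  refine ⟨v, l, r, f ((v + q ^ l * 1 : ℕ) + 1) - f (v + q ^ l * 1 : ℕ) - T.valueFrom r 1,
    fun n hn => ?_⟩
  have := tendsto_nhds_unique (key n hn) (key 1 le_rfl)
  simp only [f] at this ⊢
  linarith

theorem IsFluctuation.not_differentiableAt (hq : 2 ≤ q) (hΨ : T.IsFluctuation Ψ)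
    (hreset : T.HasResetSequence) (hint : T.HasIntegerOutput) (he : ∀ k : ℤ, T.mainConstant ≠ k)
    (x : ℝ) : ¬ DifferentiableAt ℝ Ψ x := by
  intro hdiff
  have hq1 : (1 : ℝ) < q := by exact_mod_cast (by omega : 1 < q)
  have h0 : (0 : ℝ) < q := by linarith
  obtain ⟨v, l, r, γ, hγ⟩ := hΨ.exists_mainTerm_sub_eq hq hreset
  set e := T.mainConstant
  set y₀ := (q : ℝ) ^ x
  have hy₀ : 0 < y₀ := by positivity
  have hf : DifferentiableAt ℝ (mainTerm q e Ψ) y₀ := by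
    have h1 : DifferentiableAt ℝ (fun y => Real.logb q y) y₀ :=
      (Real.differentiableAt_log hy₀.ne').div_const _
    have h2 : DifferentiableAt ℝ (fun y => Ψ (Real.logb q y)) y₀ := by
      refine DifferentiableAt.comp (g := Ψ) y₀ ?_ h1
      rwa [Real.logb_rpow h0 hq1.ne']
    exact differentiableAt_id.mul ((h1.const_mul e).add h2)
  let n : ℕ → ℕ := fun m => ⌊y₀ * q ^ m⌋₊
  let ε : ℕ → ℝ := fun m => ((q : ℝ) ^ (m + l))⁻¹
  let a : ℕ → ℝ := fun m => (v + q ^ l * n m : ℕ) * ε m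
  have hε0 (m : ℕ) : 0 < ε m := by positivity
  have hpow : Tendsto (fun k : ℕ => (q : ℝ) ^ k) atTop atTop := tendsto_pow_atTop_atTop_of_one_lt hq1
  have hε : Tendsto ε atTop (𝓝 0) :=
    (hpow.comp (tendsto_add_atTop_nat l)).inv_tendsto_atTop
  -- The block need not contain `y₀`; its distance from `y₀` only has to be comparable to its
  -- length.
  have ha (m : ℕ) : |a m - y₀| ≤ (v + q ^ l) * ε m := by
    have h1 : a m - y₀ = ((v : ℝ) + q ^ l * (n m - y₀ * q ^ m)) * ε m := by
      simp only [a, ε]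
      push_cast
      field_simp
      ring
    rw [h1, abs_mul, abs_of_pos (hε0 m)]
    refine mul_le_mul_of_nonneg_right ?_ (hε0 m).le
    have h2 : (n m : ℝ) ≤ y₀ * q ^ m := Nat.floor_le (by positivity)
    have h3 : y₀ * q ^ m < n m + 1 := Nat.lt_floor_add_one _
    have h4 : (0 : ℝ) < q ^ l := by positivity
    rw [abs_le]
    constructor <;> nlinarith [v.cast_nonneg (α := ℝ)]
  have hlim := hf.hasDerivAt.tendsto_div_of_abs_sub_le hε hε0 ha (b := fun m => a m + ε m)
    fun m => rfl
  have hn : Tendsto n atTop atTop := tendsto_nat_floor_atTop.comp (hpow.const_mul_atTop hy₀)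
  have hlim' : Tendsto (fun m => γ + T.valueFrom r (n m) - e * (m + l : ℕ)) atTop
      (𝓝 (deriv (mainTerm q e Ψ) y₀)) := by
    refine hlim.congr' ?_
    filter_upwards [hn.eventually_ge_atTop 1] with m hm
    have hqm : (0 : ℝ) < q ^ (m + l) := by positivity
    have hpos : 0 < a m := by
      have : 0 < v + q ^ l * n m := by
        have : 0 < q ^ l * n m := by positivity
        omega
      have : (0 : ℝ) < (v + q ^ l * n m : ℕ) := by exact_mod_cast this
      exact mul_pos this (hε0 m)
    have h1 : (q : ℝ) ^ (m + l) * a m = (v + q ^ l * n m : ℕ) := by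
      simp only [a, ε]
      field_simp
    have h2 : (q : ℝ) ^ (m + l) * (a m + ε m) = (v + q ^ l * n m : ℕ) + 1 := by
      rw [mul_add, h1, mul_inv_cancel₀ hqm.ne']
    have h3 := hγ (n m) hm
    rw [← h2, ← h1, mainTerm_pow_mul hq e hΨ.periodic hpos,
      mainTerm_pow_mul hq e hΨ.periodic (add_pos hpos (hε0 m))] at h3
    have h4 : (q : ℝ) ^ (m + l) * ε m = 1 := mul_inv_cancel₀ hqm.ne'
    rw [div_eq_mul_inv, inv_inv]
    linear_combination h3 - e * (m + l : ℕ) * h4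
  -- Consecutive terms of the convergent sequence cancel γ and leave one e.
  have hint' : Tendsto (fun m => T.valueFrom r (n (m + 1)) - T.valueFrom r (n m)) atTop (𝓝 e) := by
    have h1 := ((hlim'.comp (tendsto_add_atTop_nat 1)).sub hlim').add_const e
    rw [sub_self, zero_add] at h1
    refine h1.congr fun m => ?_
    simp only [Function.comp_apply]
    push_cast
    ring
  have hmem : e ∈ Set.range ((↑) : ℤ → ℝ) := by
    refine Int.isClosedEmbedding_coe_real.isClosed_range.mem_of_tendsto hint'
      (Eventually.of_forall fun m => ?_)
    obtain ⟨k₁, h₁⟩ := T.exists_int_eq_outputSum hint r (inputWord q (n (m + 1)))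
    obtain ⟨k₂, h₂⟩ := T.exists_int_eq_outputSum hint r (inputWord q (n m))
    exact ⟨k₁ - k₂, by rw [valueFrom, valueFrom, h₁, h₂, Int.cast_sub]⟩
  obtain ⟨k, hk⟩ := hmem
  exact he k hk.symm

end Fluctuation

end Transducer

theorem theorem3 (q : ℕ) [NeZero q] (hq : 2 ≤ q) {S : Type*} [Fintype S] [DecidableEq S]
    (T : Transducer q S) (hreset : T.HasResetSequence) (hint : T.HasIntegerOutput)
    (he : ∀ k : ℤ, T.mainConstant ≠ k) :
    (∃! Ψ : ℝ → ℝ, T.IsFluctuation Ψ) ∧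
      ∀ Ψ : ℝ → ℝ, T.IsFluctuation Ψ → ∀ x : ℝ, ¬ DifferentiableAt ℝ Ψ x := by
  obtain ⟨Ψ, hΨ⟩ := Transducer.exists_isFluctuation hq hreset
  exact ⟨⟨Ψ, hΨ, fun Φ hΦ => hΦ.eq hq hΨ⟩,
    fun Φ hΦ x => hΦ.not_differentiableAt hq hreset hint he x⟩
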